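/- Let $A\in\mathbb R^{n\times n}$, $B\in\mathbb R^{n\times m}$, $C\in\mathbb R^{p\times n}$ with $(A,B)$ controllable and $(C,A)$ observable, let $Q\in\mathbb R^{p\times p}$ be symmetric positive semidefinite with $(\sqrt Q\,C,A)$ observable, and let $R\in\mathbb R^{m\times m}$ be symmetric positive definite. For a linear system $\dot x=Ax+Bu$, $y=Cx$, call a matrix $K$ an optimal gain if, from every initial state, the feedback $u=-Kx$ attains the minimum, which is finite, of $\int_0^\infty (y^\top Qy+u^\top Ru)\,dt$ over all locally integrable inputs $u$. Let $K^*$ be the optimal gain of the plant $(A,B,C)$. Let $M\in\mathbb R^{n\times n}$ be Hurwitz with $n$ distinct real eigenvalues $\lambda_1,\dots,\lambda_n$, and let $\Lambda_M=\mathrm{diag}(\lambda_1,\dots,\lambda_n)$. Consider the filter $\dot Z=MZ+[\,y^\top\otimes I_n\ \ u^\top\otimes I_n\,]$, $Z(0)=Z_0$, with $Z(t)\in\mathbb R^{n\times (p+m)n}$, driven by the input and output of the plant. Then there exist a nonsingular $T\in\mathbb R^{n\times n}$ and $\theta\in\mathbb R^{(p+m)n}$ such that, along all trajectories of plant and filter,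 $$Tx(t)=Z(t)\theta+e^{Mt}(Tx(0)-Z_0\theta),\qquad t\ge 0. \tag{1}$$ Moreover, let $T$ (nonsingular) and $\theta$ satisfy (1), and let $\Gamma\in\mathbb R^{n\times n}$ be any constant matrix. Put $$A_z=I_{(p+m)n}\otimes M,\quad B_\xi=\begin{bmatrix}0\\ I_m\otimes \mathrm{vec}(I_n)\end{bmatrix},\quad L_z=\begin{bmatrix}I_p\otimes \mathrm{vec}(I_n)\\ 0\end{bmatrix},\quad C_\xi=C(\theta^\top\otimes T^{-1}),\quad A_\xi=A_z+L_zC_\xi,$$ $$A_\zeta=\begin{bmatrix}A_\xi & L_zCT^{-1}\Gamma\\ 0&\Lambda_M\end{bmatrix},\quad B_\zeta=\begin{bmatrix}B_\xi\\0\end{bmatrix},\quad C_\zeta=\begin{bmatrix}C_\xi & CT^{-1}\Gamma\end{bmatrix},$$ where the state is $\zeta=(z,\varepsilon)$ with $z\in\mathbb R^{n^2(p+m)}$ and $\varepsilon\in\mathbb R^n$. Then the LQR problem for $\dot\zeta=A_\zeta\zeta+B_\zeta u$, $y_\zeta=C_\zeta\zeta$, with cost $\int_0^\infty(y_\zeta^\top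 Qy_\zeta+u^\top Ru)\,dt$, is solvable: it has exactly one optimal gain $[\,K_z^*\ \ K_\varepsilon^*\,]$, that is, one optimal law $u=-K_z^*z-K_\varepsilon^*\varepsilon$ for all initial states (in particular for $\zeta(0)=(0,\mathbf 1_n)$), and $$K_z^*=K^*(\theta^\top\otimes T^{-1}).$$ -/

import Mathlib

open MeasureTheory Set
open scoped Matrix Kronecker MatrixOrder ENNReal

noncomputable section

namespace KreisselmeierLQR

section Systems

variable {ι κ π : Type*} [Fintype ι] [DecidableEq ι] [Fintype κ] [Fintype π]

/-- A real square matrix is Hurwitz: all its complex eigenvalues have negative real part. -/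
def IsHurwitz (M : Matrix ι ι ℝ) : Prop :=
  ∀ μ ∈ spectrum ℂ (M.map Complex.ofReal), μ.re < 0

/-- `(A, B)` is controllable: `[B, AB, …, A^(n-1) B]` has rank `n`. -/
def IsControllable {n : ℕ} (A : Matrix (Fin n) (Fin n) ℝ) (B : Matrix (Fin n) κ ℝ) : Prop :=
  (Matrix.of fun (i : Fin n) (kj : Fin n × κ) => (A ^ (kj.1 : ℕ) * B) i kj.2).rank = n

/-- `(C, A)` is observable: the stack of `C, CA, …, C A^(n-1)` has rank `n`. -/
def IsObservable {n : ℕ} (C : Matrix π (Fin n) ℝ) (A : Matrix (Fin n) (Fin n) ℝ) : Prop :=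
  (Matrix.of fun (kj : Fin n × π) (i : Fin n) => (C * A ^ (kj.1 : ℕ)) kj.2 i).rank = n

/-- `x` is the (Carathéodory) solution on `[0, ∞)` of `x' = A x + B u`, `x 0 = x₀`, for a locally
integrable input `u`. -/
structure IsTrajectory (A : Matrix ι ι ℝ) (B : Matrix ι κ ℝ) (x₀ : ι → ℝ)
    (u : ℝ → κ → ℝ) (x : ℝ → ι → ℝ) : Prop where
  input : ∀ t, 0 ≤ t → IntervalIntegrable u volume 0 t
  state : ContinuousOn x (Ici 0)
  dynamics : ∀ t, 0 ≤ t → x t = x₀ + ∫ s in (0 : ℝ)..t, (A *ᵥ x s + B *ᵥ u s)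

/-- The cost `∫₀^∞ (yᵀ Q y + uᵀ R u) dt` with `y = C x`, as a value in `[0, ∞]`
(for `Q` and `R` positive semidefinite). -/
def cost (C : Matrix π ι ℝ) (Q : Matrix π π ℝ) (R : Matrix κ κ ℝ)
    (u : ℝ → κ → ℝ) (x : ℝ → ι → ℝ) : ℝ≥0∞ :=
  ∫⁻ t in Ici (0 : ℝ),
    ENNReal.ofReal ((C *ᵥ x t) ⬝ᵥ (Q *ᵥ (C *ᵥ x t)) + u t ⬝ᵥ (R *ᵥ u t))

/-- The state feedback `u = -K x` solves the LQR problem of `x' = A x + B u`, `y = C x`: from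
every initial state, the closed loop has finite cost, and no other input has a smaller cost. -/
def IsOptimalGain (A : Matrix ι ι ℝ) (B : Matrix ι κ ℝ) (C : Matrix π ι ℝ)
    (Q : Matrix π π ℝ) (R : Matrix κ κ ℝ) (K : Matrix κ ι ℝ) : Prop :=
  ∀ x₀ : ι → ℝ, ∃ x : ℝ → ι → ℝ,
    IsTrajectory A B x₀ (fun t => -(K *ᵥ x t)) x ∧
    cost C Q R (fun t => -(K *ᵥ x t)) x < ∞ ∧
    ∀ (u' : ℝ → κ → ℝ) (x' : ℝ → ι → ℝ), IsTrajectory A B x₀ u' x' →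
      cost C Q R (fun t => -(K *ᵥ x t)) x ≤ cost C Q R u' x'

end Systems

section Filter

variable {n m p : ℕ}

/-- Column index of the filter state `Z`: the `pn` columns driven by `y`, then the `mn` columns
driven by `u`. -/
abbrev FilterCol (n m p : ℕ) : Type := (Fin p × Fin n) ⊕ (Fin m × Fin n)

/-- Index of `z = vec Z` (columns of `Z` stacked): column index first, row index second. -/
abbrev FilterIdx (n m p : ℕ) : Type := FilterCol n m p × Fin n

/-- The matrix `[yᵀ ⊗ Iₙ, uᵀ ⊗ Iₙ]`. -/
def filterInput (y : Fin p → ℝ) (u : Fin m → ℝ) : Matrix (Fin n) (FilterCol n m p) ℝ :=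
  Matrix.fromCols
    ((Matrix.replicateRow Unit y ⊗ₖ (1 : Matrix (Fin n) (Fin n) ℝ)).submatrix
      (fun i => ((), i)) id)
    ((Matrix.replicateRow Unit u ⊗ₖ (1 : Matrix (Fin n) (Fin n) ℝ)).submatrix
      (fun i => ((), i)) id)

/-- `Z` solves the filter equation `Z' = M Z + [yᵀ ⊗ Iₙ, uᵀ ⊗ Iₙ]`, `Z 0 = Z₀`, on `[0, ∞)`. -/
structure IsFilterTrajectory (M : Matrix (Fin n) (Fin n) ℝ) (y : ℝ → Fin p → ℝ)
    (u : ℝ → Fin m → ℝ) (Z₀ : Matrix (Fin n) (FilterCol n m p) ℝ)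
    (Z : ℝ → Matrix (Fin n) (FilterCol n m p) ℝ) : Prop where
  state : ContinuousOn Z (Ici 0)
  dynamics : ∀ t, 0 ≤ t → ∀ i c,
    Z t i c = Z₀ i c + ∫ s in (0 : ℝ)..t, ((M * Z s) i c + filterInput (y s) (u s) i c)

/-- `T` is nonsingular and, along all trajectories of the plant and of the filter driven by it,
`T x(t) = Z(t) θ + e^{Mt} (T x₀ - Z₀ θ)`. -/
def IsFilterRepresentation (A : Matrix (Fin n) (Fin n) ℝ) (B : Matrix (Fin n) (Fin m) ℝ)
    (C : Matrix (Fin p) (Fin n) ℝ) (M T : Matrix (Fin n) (Fin n) ℝ)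
    (θ : FilterCol n m p → ℝ) : Prop :=
  IsUnit T.det ∧
  ∀ (x₀ : Fin n → ℝ) (Z₀ : Matrix (Fin n) (FilterCol n m p) ℝ) (u : ℝ → Fin m → ℝ)
    (x : ℝ → Fin n → ℝ) (Z : ℝ → Matrix (Fin n) (FilterCol n m p) ℝ),
    IsTrajectory A B x₀ u x →
    IsFilterTrajectory M (fun t => C *ᵥ x t) u Z₀ Z →
    ∀ t, 0 ≤ t →
      T *ᵥ x t = Z t *ᵥ θ + NormedSpace.exp (t • M) *ᵥ (T *ᵥ x₀ - Z₀ *ᵥ θ)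

/-- `θᵀ ⊗ T⁻¹`. -/
def filterProj (T : Matrix (Fin n) (Fin n) ℝ) (θ : FilterCol n m p → ℝ) :
    Matrix (Fin n) (FilterIdx n m p) ℝ :=
  (Matrix.replicateRow Unit θ ⊗ₖ T⁻¹).submatrix (fun i => ((), i)) id

/-- `A_z = I ⊗ M`. -/
def filterA (m p : ℕ) (M : Matrix (Fin n) (Fin n) ℝ) :
    Matrix (FilterIdx n m p) (FilterIdx n m p) ℝ :=
  (1 : Matrix (FilterCol n m p) (FilterCol n m p) ℝ) ⊗ₖ M

/-- `B_ξ`: the zero block above `I_m ⊗ vec Iₙ`. -/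
def filterB (n m p : ℕ) : Matrix (FilterIdx n m p) (Fin m) ℝ :=
  Matrix.of fun r l => Sum.elim (fun _ => 0)
    (fun jk => (1 : Matrix (Fin m) (Fin m) ℝ) jk.1 l *
      Matrix.vec (1 : Matrix (Fin n) (Fin n) ℝ) (jk.2, r.2)) r.1

/-- `L_z`: `I_p ⊗ vec Iₙ` above the zero block. -/
def filterL (n m p : ℕ) : Matrix (FilterIdx n m p) (Fin p) ℝ :=
  Matrix.of fun r l => Sum.elim
    (fun jk => (1 : Matrix (Fin p) (Fin p) ℝ) jk.1 l *
      Matrix.vec (1 : Matrix (Fin n) (Fin n) ℝ) (jk.2, r.2)) (fun _ => 0) r.1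

/-- `C_ξ = C (θᵀ ⊗ T⁻¹)`. -/
def realC (C : Matrix (Fin p) (Fin n) ℝ) (T : Matrix (Fin n) (Fin n) ℝ)
    (θ : FilterCol n m p → ℝ) : Matrix (Fin p) (FilterIdx n m p) ℝ :=
  C * filterProj T θ

/-- `A_ξ = A_z + L_z C_ξ`. -/
def realA (C : Matrix (Fin p) (Fin n) ℝ) (M T : Matrix (Fin n) (Fin n) ℝ)
    (θ : FilterCol n m p → ℝ) : Matrix (FilterIdx n m p) (FilterIdx n m p) ℝ :=
  filterA m p M + filterL n m p * realC C T θ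

/-- `A_ζ = [[A_ξ, L_z C T⁻¹ Γ], [0, Λ_M]]` with `Λ_M = diag(lam)`. -/
def augA (C : Matrix (Fin p) (Fin n) ℝ) (M T : Matrix (Fin n) (Fin n) ℝ)
    (θ : FilterCol n m p → ℝ) (Γ : Matrix (Fin n) (Fin n) ℝ) (lam : Fin n → ℝ) :
    Matrix (FilterIdx n m p ⊕ Fin n) (FilterIdx n m p ⊕ Fin n) ℝ :=
  Matrix.fromBlocks (realA C M T θ) (filterL n m p * C * T⁻¹ * Γ) 0 (Matrix.diagonal lam)

/-- `B_ζ = [B_ξ; 0]`. -/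
def augB (n m p : ℕ) : Matrix (FilterIdx n m p ⊕ Fin n) (Fin m) ℝ :=
  Matrix.fromRows (filterB n m p) 0

/-- `C_ζ = [C_ξ, C T⁻¹ Γ]`. -/
def augC (C : Matrix (Fin p) (Fin n) ℝ) (T : Matrix (Fin n) (Fin n) ℝ)
    (θ : FilterCol n m p → ℝ) (Γ : Matrix (Fin n) (Fin n) ℝ) :
    Matrix (Fin p) (FilterIdx n m p ⊕ Fin n) ℝ :=
  Matrix.fromCols (realC C T θ) (C * T⁻¹ * Γ)

end Filter

end KreisselmeierLQR

end

set_option linter.unusedSectionVars false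

namespace KreisselmeierLQR

open Filter Topology

section Primitives

variable {ι κ : Type*} [Fintype ι] [Fintype κ]

/-- On `[0, ∞)`, `x` is locally absolutely continuous with derivative `f`. -/
def IsPrimitive (x f : ℝ → ℝ) : Prop :=
  ∀ t, 0 ≤ t → IntervalIntegrable f volume 0 t ∧ x t = x 0 + ∫ s in (0 : ℝ)..t, f s

namespace IsPrimitive

variable {x y f g : ℝ → ℝ}

theorem congr (h : IsPrimitive x f) (hxy : ∀ t, 0 ≤ t → x t = y t)
    (hfg : ∀ t, 0 ≤ t → f t = g t) : IsPrimitive y g := by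
  intro t ht
  have hfg' : EqOn f g (uIoc 0 t) := fun s hs => by
    rw [uIoc_of_le ht] at hs
    exact hfg s hs.1.le
  have hfg'' : EqOn f g (uIcc 0 t) := fun s hs => by
    rw [uIcc_of_le ht] at hs
    exact hfg s hs.1
  refine ⟨(h t ht).1.congr hfg', ?_⟩
  rw [← hxy t ht, ← hxy 0 le_rfl, ← intervalIntegral.integral_congr hfg'']
  exact (h t ht).2

theorem add (hx : IsPrimitive x f) (hy : IsPrimitive y g) :
    IsPrimitive (fun t => x t + y t) (fun t => f t + g t) := by
  intro t ht
  refine ⟨(hx t ht).1.add (hy t ht).1, ?_⟩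
  have h1 := (hx t ht).2
  have h2 := (hy t ht).2
  rw [intervalIntegral.integral_add (hx t ht).1 (hy t ht).1]
  linarith

theorem const_mul (c : ℝ) (hx : IsPrimitive x f) :
    IsPrimitive (fun t => c * x t) (fun t => c * f t) := by
  intro t ht
  refine ⟨(hx t ht).1.const_mul c, ?_⟩
  have h1 := congrArg (c * ·) (hx t ht).2
  rw [intervalIntegral.integral_const_mul]
  linarith

theorem sum {s : Finset ι} {x f : ι → ℝ → ℝ} (h : ∀ i ∈ s, IsPrimitive (x i) (f i)) :
    IsPrimitive (fun t => ∑ i ∈ s, x i t) (fun t => ∑ i ∈ s, f i t) := by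
  intro t ht
  have hi : ∀ i ∈ s, IntervalIntegrable (f i) volume 0 t := fun i hi => (h i hi t ht).1
  refine ⟨(IntervalIntegrable.sum s hi).congr fun r _ => by simp, ?_⟩
  rw [intervalIntegral.integral_finsetSum hi, ← Finset.sum_add_distrib]
  exact Finset.sum_congr rfl fun i hi => (h i hi t ht).2

theorem absolutelyContinuousOnInterval (h : IsPrimitive x f) {t : ℝ} (ht : 0 ≤ t) :
    AbsolutelyContinuousOnInterval (fun s => x 0 + ∫ r in (0 : ℝ)..s, f r) 0 t :=
  ((LipschitzWith.const (x 0)).lipschitzOnWith.absolutelyContinuousOnInterval).add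
    ((h t ht).1.absolutelyContinuousOnInterval_intervalIntegral (by simp))

theorem eqOn (h : IsPrimitive x f) {t : ℝ} (ht : 0 ≤ t) :
    EqOn x (fun s => x 0 + ∫ r in (0 : ℝ)..s, f r) (uIcc 0 t) := fun s hs => by
  rw [uIcc_of_le ht] at hs
  exact (h s hs.1).2

theorem continuousOn (h : IsPrimitive x f) {t : ℝ} (ht : 0 ≤ t) : ContinuousOn x (uIcc 0 t) :=
  (h.absolutelyContinuousOnInterval ht).continuousOn.congr (h.eqOn ht)

theorem continuousOn_Ici (h : IsPrimitive x f) : ContinuousOn x (Ici 0) := by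
  intro s hs
  have hs : 0 ≤ s := hs
  have h1 : 0 ≤ s + 1 := by linarith
  have := h.continuousOn h1 s (by rw [uIcc_of_le h1]; constructor <;> linarith)
  rw [uIcc_of_le h1] at this
  refine this.mono_of_mem_nhdsWithin ?_
  refine mem_nhdsWithin.2 ⟨Iio (s + 1), isOpen_Iio, by simp, fun r hr => ⟨hr.2, hr.1.le⟩⟩

theorem mul (hx : IsPrimitive x f) (hy : IsPrimitive y g) :
    IsPrimitive (fun t => x t * y t) (fun t => f t * y t + x t * g t) := by
  intro t ht
  refine ⟨((hx t ht).1.mul_continuousOn (hy.continuousOn ht)).add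
    ((hy t ht).1.continuousOn_mul (hx.continuousOn ht)), ?_⟩
  have key := (hx.absolutelyContinuousOnInterval ht).integral_deriv_mul_eq_sub
    (hy.absolutelyContinuousOnInterval ht)
  have hc : ∫ s in (0 : ℝ)..t, (f s * y s + x s * g s) =
      ∫ s in (0 : ℝ)..t, (deriv (fun s => x 0 + ∫ r in (0 : ℝ)..s, f r) s *
        (y 0 + ∫ r in (0 : ℝ)..s, g r) +
        (x 0 + ∫ r in (0 : ℝ)..s, f r) * deriv (fun s => y 0 + ∫ r in (0 : ℝ)..s, g r) s) := by
    apply intervalIntegral.integral_congr_ae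
    filter_upwards [(hx t ht).1.ae_hasDerivAt_integral, (hy t ht).1.ae_hasDerivAt_integral]
      with s h1 h2 hs
    have hs' := uIoc_subset_uIcc hs
    rw [((h1 hs' 0 (by simp)).const_add (x 0)).deriv, ((h2 hs' 0 (by simp)).const_add (y 0)).deriv,
      hx.eqOn ht hs', hy.eqOn ht hs']
  rw [hc, key, ← (hx t ht).2, ← (hy t ht).2]
  simp

theorem of_hasDerivAt (h : ∀ t, HasDerivAt x (f t) t) (hf : Continuous f) : IsPrimitive x f := by
  intro t _
  refine ⟨hf.intervalIntegrable 0 t, ?_⟩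
  rw [intervalIntegral.integral_eq_sub_of_hasDerivAt (fun s _ => h s) (hf.intervalIntegrable 0 t)]
  ring

theorem eq_of_zero (h : IsPrimitive x f) (hf : ∀ t, 0 ≤ t → f t = 0) {t : ℝ} (ht : 0 ≤ t) :
    x t = x 0 := by
  have := (h.congr (fun _ _ => rfl) hf t ht).2
  simpa using this

theorem le_of_nonneg (h : IsPrimitive x f) {s t : ℝ} (hs : 0 ≤ s) (hst : s ≤ t)
    (hf : ∀ r, s ≤ r → 0 ≤ f r) : x s ≤ x t := by
  have ht := hs.trans hst
  rw [(h s hs).2, (h t ht).2, ← intervalIntegral.integral_add_adjacent_intervals (h s hs).1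
    ((h s hs).1.symm.trans (h t ht).1)]
  have : 0 ≤ ∫ r in s..t, f r :=
    intervalIntegral.integral_nonneg hst fun r hr => hf r hr.1
  linarith

end IsPrimitive

/-- Componentwise version of `IsPrimitive`. -/
def IsVecPrimitive (x f : ℝ → ι → ℝ) : Prop :=
  ∀ i, IsPrimitive (fun t => x t i) (fun t => f t i)

namespace IsVecPrimitive

variable {x y f g : ℝ → ι → ℝ}

theorem congr (h : IsVecPrimitive x f) (hxy : ∀ t, 0 ≤ t → x t = y t)
    (hfg : ∀ t, 0 ≤ t → f t = g t) : IsVecPrimitive y g := fun i =>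
  (h i).congr (fun t ht => by rw [hxy t ht]) (fun t ht => by rw [hfg t ht])

theorem add (hx : IsVecPrimitive x f) (hy : IsVecPrimitive y g) :
    IsVecPrimitive (fun t => x t + y t) (fun t => f t + g t) := fun i => (hx i).add (hy i)

theorem mulVec (P : Matrix κ ι ℝ) (hx : IsVecPrimitive x f) :
    IsVecPrimitive (fun t => P *ᵥ x t) (fun t => P *ᵥ f t) := fun i =>
  IsPrimitive.sum fun j _ => (hx j).const_mul (P i j)

theorem dotProduct (hx : IsVecPrimitive x f) (hy : IsVecPrimitive y g) :
    IsPrimitive (fun t => x t ⬝ᵥ y t) (fun t => f t ⬝ᵥ y t + x t ⬝ᵥ g t) := by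
  have := IsPrimitive.sum (s := Finset.univ) fun i _ => (hx i).mul (hy i)
  simp only [Finset.sum_add_distrib] at this
  exact this

theorem continuousOn_Ici (h : IsVecPrimitive x f) : ContinuousOn x (Ici 0) :=
  continuousOn_pi.2 fun i => (h i).continuousOn_Ici

theorem of_hasDerivAt (h : ∀ t, HasDerivAt x (f t) t) (hf : Continuous f) :
    IsVecPrimitive x f := fun i =>
  IsPrimitive.of_hasDerivAt (fun t => hasDerivAt_pi.1 (h t) i) ((continuous_apply i).comp hf)

theorem _root_.Matrix.exists_dotProduct_mulVec_le (F : Matrix ι κ ℝ) :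
    ∃ c, 0 ≤ c ∧ ∀ x y, |x ⬝ᵥ F *ᵥ y| ≤ c * (x ⬝ᵥ x + y ⬝ᵥ y) := by
  refine ⟨∑ i, ∑ j, |F i j|, by positivity, fun x y => ?_⟩
  have e : x ⬝ᵥ F *ᵥ y = ∑ i, ∑ j, F i j * (x i * y j) := by
    simp only [Matrix.mulVec, _root_.dotProduct, Finset.mul_sum]
    exact Finset.sum_congr rfl fun i _ => Finset.sum_congr rfl fun j _ => by ring
  rw [e, Finset.sum_mul]
  refine (Finset.abs_sum_le_sum_abs _ _).trans (Finset.sum_le_sum fun i _ => ?_)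
  rw [Finset.sum_mul]
  refine (Finset.abs_sum_le_sum_abs _ _).trans (Finset.sum_le_sum fun j _ => ?_)
  rw [abs_mul]
  refine mul_le_mul_of_nonneg_left ?_ (abs_nonneg _)
  have hi : x i * x i ≤ x ⬝ᵥ x :=
    Finset.single_le_sum (f := fun i => x i * x i) (fun i _ => mul_self_nonneg _) (Finset.mem_univ i)
  have hj : y j * y j ≤ y ⬝ᵥ y :=
    Finset.single_le_sum (f := fun i => y i * y i) (fun i _ => mul_self_nonneg _) (Finset.mem_univ j)
  rw [abs_le]
  constructor <;> nlinarith [sq_nonneg (x i + y j), sq_nonneg (x i - y j)]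

/-- A linear differential equation has at most one solution. -/
theorem eq_zero (F : Matrix ι ι ℝ) (h : IsVecPrimitive x (fun t => F *ᵥ x t)) (h0 : x 0 = 0)
    {t : ℝ} (ht : 0 ≤ t) : x t = 0 := by
  obtain ⟨c, hc, hF⟩ := F.exists_dotProduct_mulVec_le
  have he : IsPrimitive (fun t => -Real.exp (-(4 * c) * t))
      (fun t => 4 * c * Real.exp (-(4 * c) * t)) := by
    refine IsPrimitive.of_hasDerivAt (fun t => ?_) (by fun_prop)
    have := (((hasDerivAt_id t).const_mul (-(4 * c))).exp).neg
    exact this.congr_deriv (by simp only [id]; ring)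
  have hm := (he.mul (h.dotProduct h)).le_of_nonneg le_rfl ht ?_
  · simp only [h0, zero_dotProduct, mul_zero] at hm
    have h1 := dotProduct_self_star_nonneg (x t)
    simp only [star_trivial] at h1
    have h2 := Real.exp_pos (-(4 * c) * t)
    have : x t ⬝ᵥ x t = 0 := by nlinarith
    exact dotProduct_self_eq_zero.1 this
  · intro s _
    have h1 := (abs_le.1 (hF (x s) (x s))).2
    rw [dotProduct_comm (F *ᵥ x s)]
    have h2 := Real.exp_pos (-(4 * c) * s)
    nlinarith

end IsVecPrimitive

theorem intervalIntegrable_pi {f : ℝ → ι → ℝ} {a b : ℝ} :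
    IntervalIntegrable f volume a b ↔ ∀ i, IntervalIntegrable (fun t => f t i) volume a b := by
  simp only [IntervalIntegrable, IntegrableOn]
  constructor
  · intro h i
    exact ⟨h.1.eval i, h.2.eval i⟩
  · intro h
    exact ⟨Integrable.of_eval fun i => (h i).1, Integrable.of_eval fun i => (h i).2⟩

theorem integral_apply {f : ℝ → ι → ℝ} {a b : ℝ} (h : IntervalIntegrable f volume a b) (i : ι) :
    (∫ t in a..b, f t) i = ∫ t in a..b, f t i := by
  have := (ContinuousLinearMap.proj (R := ℝ) (φ := fun _ : ι => ℝ) i).intervalIntegral_comp_comm h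
  simpa using this.symm

variable [DecidableEq ι] {A : Matrix ι ι ℝ} {B : Matrix ι κ ℝ} {x₀ : ι → ℝ} {u : ℝ → κ → ℝ}
  {x : ℝ → ι → ℝ}

theorem IsVecPrimitive.intervalIntegrable {x f : ℝ → ι → ℝ} (h : IsVecPrimitive x f) {t : ℝ}
    (ht : 0 ≤ t) : IntervalIntegrable f volume 0 t :=
  intervalIntegrable_pi.2 fun i => (h i t ht).1

theorem intervalIntegrable_mulVec {u : ℝ → κ → ℝ} {a b : ℝ} (B : Matrix ι κ ℝ)
    (h : IntervalIntegrable u volume a b) :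
    IntervalIntegrable (fun t => B *ᵥ u t) volume a b := by
  refine intervalIntegrable_pi.2 fun i => ?_
  have := IntervalIntegrable.sum Finset.univ fun j _ => (intervalIntegrable_pi.1 h j).const_mul (B i j)
  exact this.congr fun t _ => by simp [Matrix.mulVec, dotProduct]

theorem uIcc_zero_subset {t : ℝ} (ht : 0 ≤ t) : uIcc 0 t ⊆ Ici (0 : ℝ) := by
  rw [uIcc_of_le ht]
  exact Icc_subset_Ici_self

theorem IsTrajectory.initial (h : IsTrajectory A B x₀ u x) : x 0 = x₀ := by
  simpa using h.dynamics 0 le_rfl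

theorem IsTrajectory.isVecPrimitive (h : IsTrajectory A B x₀ u x) :
    IsVecPrimitive x (fun t => A *ᵥ x t + B *ᵥ u t) := by
  intro i t ht
  have hx : IntervalIntegrable x volume 0 t :=
    (h.state.mono (uIcc_zero_subset ht)).intervalIntegrable
  have hi := (intervalIntegrable_mulVec A hx).add (intervalIntegrable_mulVec B (h.input t ht))
  refine ⟨intervalIntegrable_pi.1 hi i, ?_⟩
  have := congrFun (h.dynamics t ht) i
  rw [Pi.add_apply, integral_apply hi] at this
  simpa only [h.initial] using this

theorem IsVecPrimitive.isTrajectory (h : IsVecPrimitive x (fun t => A *ᵥ x t + B *ᵥ u t))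
    (hu : ∀ t, 0 ≤ t → IntervalIntegrable u volume 0 t) : IsTrajectory A B (x 0) u x where
  input := hu
  state := h.continuousOn_Ici
  dynamics t ht := by
    ext i
    rw [Pi.add_apply, integral_apply (h.intervalIntegrable ht)]
    exact (h i t ht).2

end Primitives

section EigenvectorAssignment

open Module

variable {𝕜 E : Type*} [Field 𝕜] [AddCommGroup E] [Module 𝕜 E] [FiniteDimensional 𝕜 E]

/-- If `f` is controllable from `U`, then `f - μ` modulo `U` has a kernel vector outside every
proper subspace spanned by such vectors for values different from `μ`. -/
theorem exists_eigenvector_mod (f : End 𝕜 E) (U : Submodule 𝕜 E)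
    (hU : ∀ W : Submodule 𝕜 E, U ≤ W → (∀ w ∈ W, f w ∈ W) → W = ⊤)
    {k : ℕ} (μ : Fin k → 𝕜) (v : Fin k → E) (hv : ∀ i, f (v i) - μ i • v i ∈ U) (hk : k < finrank 𝕜 E)
    (ν : 𝕜) (hν : ∀ i, μ i ≠ ν) :
    ∃ w, f w - ν • w ∈ U ∧ w ∉ Submodule.span 𝕜 (range v) := by
  by_contra! hcon
  set W := Submodule.span 𝕜 (range v) with hW
  set g : End 𝕜 E := f - ν • LinearMap.id with hg
  have hgv : ∀ x, g x = f x - ν • x := fun x => by simp [hg]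
  have hWV : W ≤ (W ⊔ U).comap g := by
    rw [hW, Submodule.span_le]
    rintro _ ⟨i, rfl⟩
    have : g (v i) = (μ i - ν) • v i + (f (v i) - μ i • v i) := by
      rw [hgv, sub_smul]; abel
    simp only [SetLike.mem_coe, Submodule.mem_comap]
    rw [this]
    exact Submodule.add_mem_sup (W.smul_mem _ (Submodule.subset_span ⟨i, rfl⟩)) (hv i)
  have hlift : ∀ w ∈ W, ∃ w' ∈ W, g w' - w ∈ U := by
    intro w hw
    refine Submodule.span_induction ?_ ?_ ?_ ?_ hw
    · rintro _ ⟨i, rfl⟩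
      refine ⟨(μ i - ν)⁻¹ • v i, W.smul_mem _ (Submodule.subset_span ⟨i, rfl⟩), ?_⟩
      have h0 : μ i - ν ≠ 0 := sub_ne_zero.2 (hν i)
      have : g ((μ i - ν)⁻¹ • v i) - v i = (μ i - ν)⁻¹ • (f (v i) - μ i • v i) := by
        have h1 : f (v i) - μ i • v i = (f (v i) - ν • v i) - (μ i - ν) • v i := by
          rw [sub_smul]; abel
        rw [map_smul, hgv, h1, smul_sub (μ i - ν)⁻¹ (f (v i) - ν • v i), inv_smul_smul₀ h0]
      rw [this]
      exact U.smul_mem _ (hv i)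
    · exact ⟨0, W.zero_mem, by simp⟩
    · rintro x y _ _ ⟨x', hx', hx⟩ ⟨y', hy', hy⟩
      refine ⟨x' + y', W.add_mem hx' hy', ?_⟩
      have := U.add_mem hx hy
      rw [map_add]
      convert this using 1; abel
    · rintro a x _ ⟨x', hx', hx⟩
      refine ⟨a • x', W.smul_mem a hx', ?_⟩
      rw [map_smul, ← smul_sub]
      exact U.smul_mem a hx
  have hcomap : (W ⊔ U).comap g ≤ W := by
    intro x hx
    obtain ⟨w, hw, r, hr, hwr⟩ := Submodule.mem_sup.1 (Submodule.mem_comap.1 hx)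
    obtain ⟨w', hw', hd⟩ := hlift w hw
    have : g (x - w') ∈ U := by
      have h2 := U.sub_mem hr hd
      rw [map_sub, ← hwr]
      convert h2 using 1; abel
    rw [hgv] at this
    have := W.add_mem (hcon _ this) hw'
    simpa using this
  have hinj : Function.Injective (W.mapQ (W ⊔ U) g hWV) := by
    rw [← LinearMap.ker_eq_bot, Submodule.mapQ, Submodule.ker_liftQ_eq_bot']
    rw [LinearMap.ker_comp, Submodule.ker_mkQ]
    exact le_antisymm hWV hcomap
  have h1 := LinearMap.finrank_le_finrank_of_injective hinj
  have h2 := Submodule.finrank_quotient_add_finrank W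
  have h3 := Submodule.finrank_quotient_add_finrank (W ⊔ U)
  have hUW : W = W ⊔ U := Submodule.eq_of_le_of_finrank_le le_sup_left (by omega)
  have hUW : U ≤ W := by rw [hUW]; exact le_sup_right
  have htop := hU W hUW fun w hw => by
    have h4 : g w ∈ W := by
      have := hWV hw
      rwa [sup_eq_left.2 hUW] at this
    have := W.add_mem h4 (W.smul_mem ν hw)
    rw [hgv] at this
    simpa using this
  have h5 : finrank 𝕜 W ≤ k := by
    have := finrank_range_le_card (R := 𝕜) v
    simpa [Set.finrank] using this
  rw [htop, finrank_top] at h5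
  omega

/-- Eigenvector assignment: if `f` is controllable from `U`, there is a basis of vectors that are
eigenvectors modulo `U` for prescribed distinct values. -/
theorem exists_linearIndependent_eigenvectors_mod (f : End 𝕜 E) (U : Submodule 𝕜 E)
    (hU : ∀ W : Submodule 𝕜 E, U ≤ W → (∀ w ∈ W, f w ∈ W) → W = ⊤)
    {k : ℕ} (hk : k ≤ finrank 𝕜 E) (μ : Fin k → 𝕜) (hμ : Function.Injective μ) :
    ∃ v : Fin k → E, LinearIndependent 𝕜 v ∧ ∀ i, f (v i) - μ i • v i ∈ U := by
  induction k with
  | zero => exact ⟨Fin.elim0, linearIndependent_empty_type, fun i => i.elim0⟩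
  | succ k ih =>
    obtain ⟨v, hv, hvU⟩ := ih (by omega) (fun i => μ i.castSucc)
      (hμ.comp (Fin.castSucc_injective k))
    obtain ⟨w, hw, hws⟩ := exists_eigenvector_mod f U hU (fun i => μ i.castSucc) v hvU (by omega)
      (μ (Fin.last k)) (fun i h => (Fin.castSucc_lt_last i).ne (hμ h))
    refine ⟨Fin.snoc v w, linearIndependent_finSnoc.2 ⟨hv, hws⟩, fun i => ?_⟩
    refine Fin.lastCases ?_ (fun i => ?_) i
    · simpa using hw
    · simpa using hvU i

end EigenvectorAssignment

section Observability

variable {n : ℕ} {π : Type*} {C : Matrix π (Fin n) ℝ} {A : Matrix (Fin n) (Fin n) ℝ}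

theorem IsObservable.eq_zero (h : IsObservable C A) {x : Fin n → ℝ}
    (hx : ∀ k : ℕ, C *ᵥ (A ^ k *ᵥ x) = 0) : x = 0 := by
  set O : Matrix (Fin n × π) (Fin n) ℝ :=
    Matrix.of fun kj i => (C * A ^ (kj.1 : ℕ)) kj.2 i with hO
  have hr : O.rank = n := h
  have hO0 : O *ᵥ x = 0 := by
    ext kj
    have := congrFun (hx kj.1) kj.2
    rw [Matrix.mulVec_mulVec] at this
    exact this
  have hker := LinearMap.finrank_range_add_finrank_ker O.mulVecLin
  rw [Matrix.rank] at hr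
  rw [hr, Module.finrank_fin_fun] at hker
  have hbot : LinearMap.ker O.mulVecLin = ⊥ := Submodule.finrank_eq_zero.1 (by omega)
  have : x ∈ LinearMap.ker O.mulVecLin := by simpa using hO0
  rw [hbot] at this
  simpa using this

theorem IsObservable.eq_top [Fintype π] (h : IsObservable C A) (W : Submodule ℝ (Fin n → ℝ))
    (hC : LinearMap.range (Cᵀ).mulVecLin ≤ W) (hA : ∀ w ∈ W, Aᵀ *ᵥ w ∈ W) : W = ⊤ := by
  set O : Matrix (Fin n × π) (Fin n) ℝ :=
    Matrix.of fun kj i => (C * A ^ (kj.1 : ℕ)) kj.2 i with hO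
  have hr : O.rank = n := h
  rw [Matrix.rank_eq_finrank_span_row] at hr
  have htop : Submodule.span ℝ (range O.row) = ⊤ :=
    Submodule.eq_top_of_finrank_eq (by rw [hr, Module.finrank_fin_fun])
  rw [eq_top_iff, ← htop, Submodule.span_le]
  rintro _ ⟨⟨k, j⟩, rfl⟩
  have hpow : ∀ k : ℕ, (C * A ^ k) j ∈ W := by
    intro k
    induction k with
    | zero =>
      classical
      refine hC ⟨Pi.single j 1, ?_⟩
      ext i
      simp
    | succ k ih =>
      have := hA _ ih
      convert this using 1
      rw [Matrix.mulVec_transpose, pow_succ, ← Matrix.mul_assoc]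
      ext i
      simp [Matrix.mul_apply, Matrix.vecMul, dotProduct]
  exact hpow k

/-- Observer eigenvalue assignment: an observable pair is diagonalized by output injection, with
prescribed distinct eigenvalues. -/
theorem IsObservable.exists_diagonal [Fintype π] (h : IsObservable C A) (lam : Fin n → ℝ)
    (hlam : Function.Injective lam) :
    ∃ (V : Matrix (Fin n) (Fin n) ℝ) (L : Matrix (Fin n) π ℝ),
      IsUnit V.det ∧ V * A = Matrix.diagonal lam * V + L * C := by
  obtain ⟨v, hv, hvU⟩ := exists_linearIndependent_eigenvectors_mod
    (Matrix.mulVecLin Aᵀ) (LinearMap.range (Cᵀ).mulVecLin)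
    (fun W h1 h2 => h.eq_top W h1 h2) (by rw [Module.finrank_fin_fun]) lam hlam
  choose l hl using hvU
  refine ⟨Matrix.of v, Matrix.of l, ?_, ?_⟩
  · rw [← Matrix.isUnit_iff_isUnit_det, ← Matrix.linearIndependent_rows_iff_isUnit]
    exact hv
  · ext i j
    have := congrFun (hl i) j
    simp only [Matrix.mulVecLin_apply, Matrix.mulVec_transpose, Pi.sub_apply, Pi.smul_apply,
      smul_eq_mul] at this
    rw [Matrix.add_apply, Matrix.diagonal_mul]
    have e1 : (Matrix.of v * A) i j = (v i ᵥ* A) j := rfl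
    have e2 : (Matrix.of l * C) i j = (l i ᵥ* C) j := rfl
    rw [e1, e2, this, Matrix.of_apply]
    ring

theorem exists_diagonalization (M : Matrix (Fin n) (Fin n) ℝ) (lam : Fin n → ℝ)
    (hlam : Function.Injective lam)
    (hM : ∀ i, Module.End.HasEigenvalue (Matrix.toLin' M) (lam i)) :
    ∃ P : Matrix (Fin n) (Fin n) ℝ, IsUnit P.det ∧ M * P = P * Matrix.diagonal lam := by
  choose v hv using fun i => (hM i).exists_hasEigenvector
  have hli := Module.End.eigenvectors_linearIndependent' (Matrix.toLin' M) lam hlam v hv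
  refine ⟨(Matrix.of v)ᵀ, ?_, ?_⟩
  · rw [Matrix.det_transpose, ← Matrix.isUnit_iff_isUnit_det,
      ← Matrix.linearIndependent_rows_iff_isUnit]
    exact hli
  · ext i j
    have := congrFun (hv j).apply_eq_smul i
    rw [Matrix.mul_diagonal, Matrix.transpose_apply, Matrix.of_apply, mul_comm]
    exact this

theorem IsHurwitz.eigenvalue_neg {M : Matrix (Fin n) (Fin n) ℝ} (h : IsHurwitz M) {μ : ℝ}
    (hμ : Module.End.HasEigenvalue (Matrix.toLin' M) μ) : μ < 0 := by
  refine h (μ : ℂ) ?_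
  obtain ⟨v, hv⟩ := hμ.exists_hasEigenvector
  rw [← Matrix.spectrum_toLin', ← Module.End.hasEigenvalue_iff_mem_spectrum]
  refine Module.End.hasEigenvalue_of_hasEigenvector (x := fun i => (v i : ℂ)) ?_
  rw [Module.End.hasEigenvector_iff, Module.End.mem_eigenspace_iff]
  refine ⟨?_, fun h0 => hv.2 ?_⟩
  · ext i
    have := congrFun hv.apply_eq_smul i
    simp only [Matrix.toLin'_apply, Matrix.mulVec, dotProduct, Pi.smul_apply, smul_eq_mul] at this
    simp only [Matrix.toLin'_apply, Matrix.mulVec, dotProduct, Pi.smul_apply, smul_eq_mul,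
      Matrix.map_apply]
    exact_mod_cast this
  · ext i
    have := congrFun h0 i
    simpa using this

end Observability

section Existence

theorem exists_hasDerivAt_linear {E : Type*} [NormedAddCommGroup E] [NormedSpace ℝ E]
    [FiniteDimensional ℝ E] (L : E →ₗ[ℝ] E) (x₀ : E) :
    ∃ x : ℝ → E, x 0 = x₀ ∧ ∀ t, HasDerivAt x (L (x t)) t := by
  have : CompleteSpace E := FiniteDimensional.complete ℝ E
  set L' : E →L[ℝ] E := LinearMap.toContinuousLinearMap L
  refine ⟨fun t => NormedSpace.exp (t • L') x₀, by simp, fun t => ?_⟩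
  have := (hasDerivAt_exp_smul_const' (𝕂 := ℝ) L' t).clm_apply (hasDerivAt_const t x₀)
  exact this.congr_deriv (by simp [L'])

theorem exists_isVecPrimitive_linear {ι : Type*} [Fintype ι] (F : Matrix ι ι ℝ) (x₀ : ι → ℝ) :
    ∃ x : ℝ → ι → ℝ, x 0 = x₀ ∧ IsVecPrimitive x (fun t => F *ᵥ x t) := by
  obtain ⟨x, h0, hx⟩ := exists_hasDerivAt_linear F.mulVecLin x₀
  refine ⟨x, h0, IsVecPrimitive.of_hasDerivAt hx ?_⟩
  have : Continuous x := continuous_iff_continuousAt.2 fun t => (hx t).continuousAt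
  exact Continuous.matrix_mulVec continuous_const this

open scoped Matrix.Norms.Operator in
theorem hasDerivAt_exp_smul_mulVec {ι : Type*} [Fintype ι] [DecidableEq ι] (M : Matrix ι ι ℝ)
    (v : ι → ℝ) (t : ℝ) :
    HasDerivAt (fun t : ℝ => NormedSpace.exp (t • M) *ᵥ v)
      (M *ᵥ (NormedSpace.exp (t • M) *ᵥ v)) t := by
  have h := hasDerivAt_exp_smul_const' (𝕂 := ℝ) M t
  let Φ : Matrix ι ι ℝ →ₗ[ℝ] (ι → ℝ) :=
    { toFun := fun X => X *ᵥ v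
      map_add' := fun X Y => Matrix.add_mulVec X Y v
      map_smul' := fun c X => Matrix.smul_mulVec c X v }
  have := (LinearMap.toContinuousLinearMap Φ).hasFDerivAt.comp_hasDerivAt t h
  rw [Matrix.mulVec_mulVec]
  exact this

end Existence

section FilterAlgebra

variable {n m p : ℕ}

/-- The matrix whose columns are the coefficients in `θ` of the filter columns driven by `y`. -/
def outputCoeff (θ : FilterCol n m p → ℝ) : Matrix (Fin n) (Fin p) ℝ :=
  Matrix.of fun i j => θ (Sum.inl (j, i))

/-- The matrix whose columns are the coefficients in `θ` of the filter columns driven by `u`. -/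
def inputCoeff (θ : FilterCol n m p → ℝ) : Matrix (Fin n) (Fin m) ℝ :=
  Matrix.of fun i j => θ (Sum.inr (j, i))

theorem filterInput_inl (y : Fin p → ℝ) (u : Fin m → ℝ) (i : Fin n) (jk : Fin p × Fin n) :
    filterInput y u i (Sum.inl jk) = y jk.1 * (1 : Matrix (Fin n) (Fin n) ℝ) i jk.2 := rfl

theorem filterInput_inr (y : Fin p → ℝ) (u : Fin m → ℝ) (i : Fin n) (jk : Fin m × Fin n) :
    filterInput y u i (Sum.inr jk) = u jk.1 * (1 : Matrix (Fin n) (Fin n) ℝ) i jk.2 := rfl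

theorem filterInput_mulVec (y : Fin p → ℝ) (u : Fin m → ℝ) (θ : FilterCol n m p → ℝ) :
    filterInput y u *ᵥ θ = outputCoeff θ *ᵥ y + inputCoeff θ *ᵥ u := by
  ext i
  simp only [Matrix.mulVec, dotProduct, Fintype.sum_sum_type, filterInput_inl, filterInput_inr,
    Pi.add_apply, outputCoeff, inputCoeff, Matrix.of_apply, Fintype.sum_prod_type, Matrix.one_apply,
    mul_ite, mul_one, mul_zero, ite_mul, zero_mul, Finset.sum_ite_eq, Finset.mem_univ, if_true]
  congr 1 <;> exact Finset.sum_congr rfl fun j _ => mul_comm _ _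

theorem IsFilterTrajectory.isVecPrimitive {M : Matrix (Fin n) (Fin n) ℝ} {y : ℝ → Fin p → ℝ}
    {u : ℝ → Fin m → ℝ} {Z₀ : Matrix (Fin n) (FilterCol n m p) ℝ}
    {Z : ℝ → Matrix (Fin n) (FilterCol n m p) ℝ} (h : IsFilterTrajectory M y u Z₀ Z)
    (hy : ContinuousOn y (Ici 0)) (hu : ∀ t, 0 ≤ t → IntervalIntegrable u volume 0 t)
    (θ : FilterCol n m p → ℝ) :
    IsVecPrimitive (fun t => Z t *ᵥ θ)
      (fun t => M *ᵥ (Z t *ᵥ θ) + (outputCoeff θ *ᵥ y t + inputCoeff θ *ᵥ u t)) := by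
  have hZ : ∀ i c, IsPrimitive (fun t => Z t i c)
      (fun t => (M * Z t) i c + filterInput (y t) (u t) i c) := by
    intro i c t ht
    have hsub := uIcc_zero_subset ht
    have h1 : IntervalIntegrable (fun s => (M * Z s) i c) volume 0 t := by
      refine ContinuousOn.intervalIntegrable ?_
      simp only [Matrix.mul_apply]
      refine continuousOn_finsetSum _ fun j _ => continuousOn_const.mul ?_
      exact (continuousOn_pi.1 (continuousOn_pi.1 h.state j) c).mono hsub
    have h2 : IntervalIntegrable (fun s => filterInput (y s) (u s) i c) volume 0 t := by
      rcases c with jk | jk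
      · simp only [filterInput_inl]
        exact (((continuousOn_pi.1 hy jk.1).mono hsub).intervalIntegrable).mul_const _
      · simp only [filterInput_inr]
        exact (intervalIntegrable_pi.1 (hu t ht) jk.1).mul_const _
    refine ⟨h1.add h2, ?_⟩
    have h0 : Z 0 i c = Z₀ i c := by simpa using h.dynamics 0 le_rfl i c
    simp only [h0]
    exact h.dynamics t ht i c
  intro i
  have := IsPrimitive.sum (s := Finset.univ) fun c _ => (hZ i c).const_mul (θ c)
  refine this.congr (fun t _ => ?_) (fun t _ => ?_)
  · simp [Matrix.mulVec, dotProduct, mul_comm]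
  · beta_reduce
    rw [← filterInput_mulVec, Matrix.mulVec_mulVec, ← Matrix.add_mulVec]
    simp [Matrix.mulVec, dotProduct, mul_comm]

/-- The algebraic form of the filter representation is sufficient. -/
theorem isFilterRepresentation_of_eq {A : Matrix (Fin n) (Fin n) ℝ} {B : Matrix (Fin n) (Fin m) ℝ}
    {C : Matrix (Fin p) (Fin n) ℝ} {M T : Matrix (Fin n) (Fin n) ℝ} {θ : FilterCol n m p → ℝ}
    (hT : IsUnit T.det) (hA : T * A = M * T + outputCoeff θ * C) (hB : T * B = inputCoeff θ) :
    IsFilterRepresentation A B C M T θ := by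
  refine ⟨hT, fun x₀ Z₀ u x Z hx hZ t ht => ?_⟩
  have hZ0 : Z 0 = Z₀ := by
    ext i c
    simpa using hZ.dynamics 0 le_rfl i c
  have h1 := (hx.isVecPrimitive).mulVec T
  have h2 := (hZ.isVecPrimitive
    (((continuous_const (y := C)).matrix_mulVec continuous_id).comp_continuousOn hx.state)
    hx.input θ).mulVec (-1 : Matrix (Fin n) (Fin n) ℝ)
  have h3 : IsVecPrimitive (fun t : ℝ => NormedSpace.exp (t • M) *ᵥ (T *ᵥ x₀ - Z₀ *ᵥ θ))
      (fun t => M *ᵥ (NormedSpace.exp (t • M) *ᵥ (T *ᵥ x₀ - Z₀ *ᵥ θ))) := by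
    have hd := hasDerivAt_exp_smul_mulVec M (T *ᵥ x₀ - Z₀ *ᵥ θ)
    refine IsVecPrimitive.of_hasDerivAt hd ?_
    exact continuous_const.matrix_mulVec
      (continuous_iff_continuousAt.2 fun t => (hd t).continuousAt)
  have h4 := (h1.add h2).add (h3.mulVec (-1 : Matrix (Fin n) (Fin n) ℝ))
  have h5 := IsVecPrimitive.eq_zero M (h4.congr (fun _ _ => rfl) fun s _ => ?_) ?_ ht
  · simp only [Matrix.neg_mulVec, Matrix.one_mulVec] at h5
    rw [← sub_eq_add_neg, ← sub_eq_add_neg, sub_eq_zero, sub_eq_iff_eq_add] at h5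
    rw [h5, add_comm]
  · have e1 : T *ᵥ (A *ᵥ x s) = M *ᵥ (T *ᵥ x s) + outputCoeff θ *ᵥ (C *ᵥ x s) := by
      simp only [Matrix.mulVec_mulVec, hA, Matrix.add_mulVec]
    have e2 : T *ᵥ (B *ᵥ u s) = inputCoeff θ *ᵥ u s := by rw [Matrix.mulVec_mulVec, hB]
    simp only [Matrix.neg_mulVec, Matrix.one_mulVec, Matrix.mulVec_add, Matrix.mulVec_neg, e1, e2]
    abel
  · simp only [hx.initial, hZ0, zero_smul, NormedSpace.exp_zero, Matrix.neg_mulVec,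
      Matrix.one_mulVec]
    abel

theorem exists_isFilterRepresentation {A : Matrix (Fin n) (Fin n) ℝ} (B : Matrix (Fin n) (Fin m) ℝ)
    {C : Matrix (Fin p) (Fin n) ℝ} (hCA : IsObservable C A) {M : Matrix (Fin n) (Fin n) ℝ}
    {lam : Fin n → ℝ} (hlam : Function.Injective lam)
    (hM : ∀ i, Module.End.HasEigenvalue (Matrix.toLin' M) (lam i)) :
    ∃ (T : Matrix (Fin n) (Fin n) ℝ) (θ : FilterCol n m p → ℝ),
      IsFilterRepresentation A B C M T θ := by
  obtain ⟨V, L, hV, hVA⟩ := hCA.exists_diagonal lam hlam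
  obtain ⟨P, hP, hMP⟩ := exists_diagonalization M lam hlam hM
  refine ⟨P * V, Sum.elim (fun ji => (P * L) ji.2 ji.1) (fun ji => (P * V * B) ji.2 ji.1),
    isFilterRepresentation_of_eq ?_ ?_ rfl⟩
  · rw [Matrix.det_mul]
    exact hP.mul hV
  · change _ = _ + P * L * C
    rw [Matrix.mul_assoc, hVA, Matrix.mul_add, ← Matrix.mul_assoc, ← hMP]
    simp only [Matrix.mul_assoc]

theorem IsFilterRepresentation.eq {A : Matrix (Fin n) (Fin n) ℝ} {B : Matrix (Fin n) (Fin m) ℝ}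
    {C : Matrix (Fin p) (Fin n) ℝ} {M T : Matrix (Fin n) (Fin n) ℝ} {θ : FilterCol n m p → ℝ}
    (h : IsFilterRepresentation A B C M T θ) :
    T * A = M * T + outputCoeff θ * C ∧ T * B = inputCoeff θ := by
  have key : ∀ (x₀ : Fin n → ℝ) (u₀ : Fin m → ℝ), T *ᵥ (A *ᵥ x₀ + B *ᵥ u₀) =
      (outputCoeff θ *ᵥ (C *ᵥ x₀) + inputCoeff θ *ᵥ u₀) + M *ᵥ (T *ᵥ x₀) := by
    intro x₀ u₀
    let L : ((Fin n → ℝ) × (Fin n → FilterCol n m p → ℝ) × (Fin m → ℝ)) →ₗ[ℝ]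
        ((Fin n → ℝ) × (Fin n → FilterCol n m p → ℝ) × (Fin m → ℝ)) :=
      { toFun := fun s => (A *ᵥ s.1 + B *ᵥ s.2.2, fun i c => (M * Matrix.of s.2.1) i c +
          filterInput (C *ᵥ s.1) s.2.2 i c, 0)
        map_add' := fun s s' => by
          refine Prod.ext ?_ (Prod.ext ?_ ?_)
          · simp only [Prod.fst_add, Prod.snd_add, Matrix.mulVec_add]
            abel
          · ext i c
            have e : (M * Matrix.of (s.2.1 + s'.2.1)) i c =
                (M * Matrix.of s.2.1) i c + (M * Matrix.of s'.2.1) i c := by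
              simp [Matrix.mul_apply, mul_add, Finset.sum_add_distrib]
            simp only [Prod.fst_add, Prod.snd_add, Pi.add_apply, e]
            rcases c with c | c <;>
              simp only [filterInput_inl, filterInput_inr, Matrix.mulVec_add, Pi.add_apply] <;> ring
          · simp
        map_smul' := fun a s => by
          refine Prod.ext ?_ (Prod.ext ?_ ?_)
          · simp only [Prod.smul_fst, Prod.smul_snd, Matrix.mulVec_smul, RingHom.id_apply, smul_add]
          · ext i c
            have e : (M * Matrix.of (a • s.2.1)) i c = a * (M * Matrix.of s.2.1) i c := by
              simp only [Matrix.mul_apply, Matrix.of_apply, Pi.smul_apply, smul_eq_mul,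
                Finset.mul_sum]
              exact Finset.sum_congr rfl fun j _ => by ring
            simp only [Prod.smul_fst, Prod.smul_snd, Pi.smul_apply, smul_eq_mul, e,
              RingHom.id_apply]
            rcases c with c | c <;>
              simp only [filterInput_inl, filterInput_inr, Matrix.mulVec_smul, Pi.smul_apply,
                smul_eq_mul] <;> ring
          · simp }
    obtain ⟨s, hs0, hs⟩ := exists_hasDerivAt_linear L (x₀, 0, u₀)
    have hsc : Continuous s := continuous_iff_continuousAt.2 fun t => (hs t).continuousAt
    have hsx : ∀ t, HasDerivAt (fun t => (s t).1) (A *ᵥ (s t).1 + B *ᵥ (s t).2.2) t :=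
      fun t => (hs t).fst
    have hsZ : ∀ t i c, HasDerivAt (fun t => (s t).2.1 i c) ((M * Matrix.of (s t).2.1) i c +
          filterInput (C *ᵥ (s t).1) (s t).2.2 i c) t :=
      fun t i c => hasDerivAt_pi.1 (hasDerivAt_pi.1 (hs t).snd.fst i) c
    have hLc : Continuous (fun t => L (s t)) := (LinearMap.continuous_of_finiteDimensional L).comp hsc
    have hx := (IsVecPrimitive.of_hasDerivAt hsx hLc.fst).isTrajectory
      (u := fun t => (s t).2.2) (fun t _ => hsc.snd.snd.intervalIntegrable 0 t)
    have hZ : IsFilterTrajectory M (fun t => C *ᵥ (s t).1) (fun t => (s t).2.2) 0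
        (fun t => Matrix.of (s t).2.1) := by
      refine ⟨hsc.snd.fst.continuousOn, fun t ht i c => ?_⟩
      have hc : Continuous fun t => (M * Matrix.of (s t).2.1) i c +
          filterInput (C *ᵥ (s t).1) (s t).2.2 i c :=
        (continuous_apply c).comp ((continuous_apply i).comp hLc.snd.fst)
      have := (IsPrimitive.of_hasDerivAt (fun t => hsZ t i c) hc t ht).2
      simpa [hs0] using this
    have hrep := h.2 _ _ _ _ _ hx hZ
    have hs0x : (s 0).1 = x₀ := by rw [hs0]
    have hs0u : (s 0).2.2 = u₀ := by rw [hs0]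
    have hs0Z : Matrix.of (s 0).2.1 = 0 := by rw [hs0]; rfl
    rw [hs0x] at hrep
    simp only [Matrix.zero_mulVec, sub_zero] at hrep
    have d1 : HasDerivAt (fun t => T *ᵥ (s t).1) (T *ᵥ (A *ᵥ x₀ + B *ᵥ u₀)) 0 := by
      have := (LinearMap.toContinuousLinearMap T.mulVecLin).hasFDerivAt.comp_hasDerivAt 0 (hsx 0)
      rw [hs0x, hs0u] at this
      exact this
    have d2 : HasDerivAt (fun t => Matrix.of (s t).2.1 *ᵥ θ)
        (outputCoeff θ *ᵥ (C *ᵥ x₀) + inputCoeff θ *ᵥ u₀) 0 := by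
      rw [← filterInput_mulVec]
      refine hasDerivAt_pi.2 fun i => ?_
      have := HasDerivAt.fun_sum (u := Finset.univ) fun c _ => (hsZ 0 i c).mul_const (θ c)
      rw [hs0x, hs0u, hs0Z] at this
      simpa [Matrix.mulVec, dotProduct] using this
    have d3 := hasDerivAt_exp_smul_mulVec M (T *ᵥ x₀) 0
    have d4 := (d2.add d3).hasDerivWithinAt (s := Ici 0)
    have d5 := d1.hasDerivWithinAt (s := Ici 0)
    have d6 := d4.congr (fun t ht => hrep t ht) (hrep 0 le_rfl)
    have := (uniqueDiffOn_Ici (0 : ℝ) 0 self_mem_Ici).eq_deriv _ d5 d6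
    simpa using this
  constructor
  · refine Matrix.ext_of_mulVec_single fun i => ?_
    have := key (Pi.single i 1) 0
    simp only [Matrix.mulVec_zero, add_zero] at this
    rw [← Matrix.mulVec_mulVec, this, Matrix.add_mulVec, Matrix.mulVec_mulVec, Matrix.mulVec_mulVec,
      add_comm]
  · refine Matrix.ext_of_mulVec_single fun i => ?_
    have := key 0 (Pi.single i 1)
    simp only [Matrix.mulVec_zero, add_zero, zero_add] at this
    rw [← Matrix.mulVec_mulVec, this]

end FilterAlgebra

section Decay

theorem IsPrimitive.integrableOn_of_bounded {x f : ℝ → ℝ} (h : IsPrimitive x f)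
    (hf : ∀ t, 0 ≤ t → 0 ≤ f t) {c : ℝ} (hc : ∀ t, 0 ≤ t → x t ≤ c) : IntegrableOn f (Ioi 0) := by
  refine integrableOn_Ioi_of_intervalIntegral_norm_bounded (c - x 0) 0 (b := id) (l := atTop)
    (fun t => ?_) tendsto_id ?_
  · rcases le_total 0 t with ht | ht
    · exact (intervalIntegrable_iff_integrableOn_Ioc_of_le ht).1 (h t ht).1
    · simp [Ioc_eq_empty (not_lt.2 ht)]
  · filter_upwards [eventually_ge_atTop 0] with t ht
    have : ∫ s in (0 : ℝ)..t, ‖f s‖ = ∫ s in (0 : ℝ)..t, f s := by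
      refine intervalIntegral.integral_congr fun s hs => ?_
      rw [uIcc_of_le ht] at hs
      exact Real.norm_of_nonneg (hf s hs.1)
    simp only [id]
    rw [this]
    have := (h t ht).2
    have := hc t ht
    linarith

/-- The stable scalar equation with square integrable input. -/
theorem IsPrimitive.tendsto_zero {w g : ℝ → ℝ} {μ : ℝ} (hμ : μ < 0)
    (h : IsPrimitive w (fun t => μ * w t + g t))
    (hg : IntegrableOn (fun t => g t ^ 2) (Ioi 0)) : Tendsto w atTop (𝓝 0) := by
  obtain ⟨a, rfl⟩ : ∃ a, μ = -a := ⟨-μ, by ring⟩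
  have ha : 0 < a := by linarith
  set G : ℝ → ℝ := fun t => ∫ s in (0 : ℝ)..t, g s ^ 2 with hG
  have hGp : IsPrimitive G (fun t => g t ^ 2) := fun t ht =>
    ⟨(intervalIntegrable_iff_integrableOn_Ioc_of_le ht).2 (hg.mono_set Ioc_subset_Ioi_self),
      by simp [hG]⟩
  set I := ∫ s in Ioi (0 : ℝ), g s ^ 2
  have hGlim : Tendsto G atTop (𝓝 I) := intervalIntegral_tendsto_integral_Ioi 0 hg tendsto_id
  have hGmono : ∀ {s t : ℝ}, 0 ≤ s → s ≤ t → G s ≤ G t := fun hs hst =>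
    hGp.le_of_nonneg hs hst fun r _ => sq_nonneg _
  have hGI : ∀ {t : ℝ}, 0 ≤ t → G t ≤ I := fun {t} ht =>
    ge_of_tendsto hGlim ((eventually_ge_atTop t).mono fun s hs => hGmono ht hs)
  have hexp : IsPrimitive (fun t => -Real.exp (a * t)) (fun t => -(a * Real.exp (a * t))) := by
    refine IsPrimitive.of_hasDerivAt (fun t => ?_) (by fun_prop)
    have := ((hasDerivAt_id t).const_mul a).exp.neg
    exact this.congr_deriv (by simp only [id]; ring)
  have hone : IsPrimitive (fun _ : ℝ => (1 : ℝ)) (fun _ => 0) :=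
    IsPrimitive.of_hasDerivAt (fun t => hasDerivAt_const t 1) continuous_const
  have bound : ∀ {S t : ℝ}, 0 ≤ S → S ≤ t →
      w t ^ 2 ≤ Real.exp (a * S) * w S ^ 2 * Real.exp (-(a * t)) + (I - G S) / a := by
    intro S t hS hSt
    have hΦ := hexp.mul (((h.mul h).add (hGp.const_mul (-1 / a))).add (hone.const_mul (G S / a)))
    have := hΦ.le_of_nonneg hS hSt ?_
    · have e0 : Real.exp (-(a * t)) * Real.exp (a * t) = 1 := by
        rw [← Real.exp_add]; simp
      have e1 := Real.exp_pos (-(a * t))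
      have e2 := mul_le_mul_of_nonneg_left this e1.le
      have e3 : (G t - G S) / a ≤ (I - G S) / a :=
        div_le_div_of_nonneg_right (by linarith [hGI (hS.trans hSt)]) ha.le
      have e4 : Real.exp (-(a * t)) * (-Real.exp (a * t) * (w t * w t + -1 / a * G t + G S / a * 1))
          = -(w t ^ 2) + (G t - G S) / a := by
        calc _ = -(Real.exp (-(a * t)) * Real.exp (a * t)) *
              (w t * w t + -1 / a * G t + G S / a * 1) := by ring
          _ = _ := by rw [e0]; ring
      have e5 : Real.exp (-(a * t)) * (-Real.exp (a * S) * (w S * w S + -1 / a * G S + G S / a * 1))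
          = -(Real.exp (a * S) * w S ^ 2 * Real.exp (-(a * t))) := by ring
      rw [e4, e5] at e2
      linarith
    · intro r hr
      have e1 := Real.exp_pos (a * r)
      have e2 := hGmono hS hr
      have e3 : (-(a * Real.exp (a * r))) * (w r * w r + -1 / a * G r + G S / a * 1) +
          -Real.exp (a * r) * ((-a * w r + g r) * w r + w r * (-a * w r + g r) +
            -1 / a * g r ^ 2 + G S / a * 0) =
          Real.exp (a * r) * ((a * w r - g r) ^ 2 / a + (G r - G S)) := by
        field_simp
        ring
      refine le_of_le_of_eq ?_ e3.symm
      have : 0 ≤ (a * w r - g r) ^ 2 / a := by positivity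
      exact mul_nonneg e1.le (by linarith)
  have hsq : Tendsto (fun t => w t ^ 2) atTop (𝓝 0) := by
    refine tendsto_order.2 ⟨fun b hb => Eventually.of_forall fun t => hb.trans_le (sq_nonneg _),
      fun b hb => ?_⟩
    have h1 : Tendsto (fun S => (I - G S) / a) atTop (𝓝 0) := by
      have := (tendsto_const_nhds (x := I)).sub hGlim |>.div_const a
      simpa using this
    obtain ⟨S, hS, hS0⟩ := ((h1.eventually (gt_mem_nhds (half_pos hb))).and
      (eventually_ge_atTop 0)).exists
    have h2 : Tendsto (fun t => Real.exp (a * S) * w S ^ 2 * Real.exp (-(a * t))) atTop (𝓝 0) := by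
      have : Tendsto (fun t => Real.exp (-(a * t))) atTop (𝓝 0) :=
        Real.tendsto_exp_neg_atTop_nhds_zero.comp (tendsto_id.const_mul_atTop ha)
      simpa using this.const_mul (Real.exp (a * S) * w S ^ 2)
    filter_upwards [h2.eventually (gt_mem_nhds (half_pos hb)), eventually_ge_atTop S] with t ht hSt
    have := bound hS0 hSt
    linarith
  have := (Real.continuous_sqrt.tendsto 0).comp hsq
  simp only [Real.sqrt_zero] at this
  refine (tendsto_zero_iff_abs_tendsto_zero _).2 (this.congr fun t => ?_)
  simp [Real.sqrt_sq_eq_abs]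

/-- Componentwise square integrability on `[0, ∞)`. -/
def IsSquareIntegrable {ι : Type*} (f : ℝ → ι → ℝ) : Prop :=
  ∀ i, MemLp (fun t => f t i) 2 (volume.restrict (Ioi 0))

theorem IsSquareIntegrable.add {ι : Type*} {f g : ℝ → ι → ℝ} (hf : IsSquareIntegrable f)
    (hg : IsSquareIntegrable g) : IsSquareIntegrable (fun t => f t + g t) :=
  fun i => (hf i).add (hg i)

theorem IsSquareIntegrable.mulVec {ι κ : Type*} [Fintype κ] {f : ℝ → κ → ℝ} (P : Matrix ι κ ℝ)
    (hf : IsSquareIntegrable f) : IsSquareIntegrable (fun t => P *ᵥ f t) := fun i =>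
  memLp_finsetSum _ fun j _ => (hf j).const_mul (P i j)

theorem IsVecPrimitive.diagonal_tendsto_zero {n : ℕ} {lam : Fin n → ℝ} (hlam : ∀ i, lam i < 0)
    {w g : ℝ → Fin n → ℝ} (h : IsVecPrimitive w (fun t => Matrix.diagonal lam *ᵥ w t + g t))
    (hg : IsSquareIntegrable g) : Tendsto w atTop (𝓝 0) := by
  refine tendsto_pi_nhds.2 fun i => ?_
  refine IsPrimitive.tendsto_zero (g := fun t => g t i) (hlam i)
    ((h i).congr (fun _ _ => rfl) fun t _ => ?_) ?_
  · simp [Matrix.mulVec_diagonal]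
  · exact (memLp_two_iff_integrable_sq (hg i).1).1 (hg i)

theorem isSquareIntegrable_of_diagonal {n : ℕ} {lam : Fin n → ℝ} (hlam : ∀ i, lam i < 0)
    {e : ℝ → Fin n → ℝ} (h : IsVecPrimitive e (fun t => Matrix.diagonal lam *ᵥ e t)) :
    IsSquareIntegrable e := by
  intro i
  have hi := (h i)
  have hmeas : AEStronglyMeasurable (fun t => e t i) (volume.restrict (Ioi 0)) :=
    (hi.continuousOn_Ici.mono Ioi_subset_Ici_self).aestronglyMeasurable measurableSet_Ioi
  rw [memLp_two_iff_integrable_sq hmeas]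
  have h2 := (hi.mul hi).const_mul (1 / (2 * lam i))
  refine IsPrimitive.integrableOn_of_bounded (c := 0)
    (h2.congr (fun _ _ => rfl) fun t _ => ?_) (fun t _ => sq_nonneg _) fun t _ => ?_
  · have := (hlam i).ne
    simp only [Matrix.mulVec_diagonal]
    field_simp
    ring
  · have : 1 / (2 * lam i) ≤ 0 := by
      rw [one_div]
      exact inv_nonpos.2 (by linarith [hlam i])
    nlinarith [mul_self_nonneg (e t i)]

/-- A trajectory of an observable system with square integrable input and output tends to `0`. -/
theorem IsObservable.tendsto_zero {n : ℕ} {π : Type*} [Fintype π] {C : Matrix π (Fin n) ℝ}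
    {A : Matrix (Fin n) (Fin n) ℝ} (hCA : IsObservable C A) {x v : ℝ → Fin n → ℝ}
    (h : IsVecPrimitive x (fun t => A *ᵥ x t + v t)) (hv : IsSquareIntegrable v)
    (hy : IsSquareIntegrable (fun t => C *ᵥ x t)) : Tendsto x atTop (𝓝 0) := by
  obtain ⟨V, L, hV, hVA⟩ := hCA.exists_diagonal (fun i => -((i : ℕ) + 1 : ℝ)) (fun i j hij => by
    simp only [neg_inj, add_left_inj, Nat.cast_inj] at hij
    exact Fin.ext hij)
  have hw := (h.mulVec V).congr (g := fun t => Matrix.diagonal (fun i : Fin n => -((i : ℕ) + 1 : ℝ))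
    *ᵥ (V *ᵥ x t) + (L *ᵥ (C *ᵥ x t) + V *ᵥ v t)) (fun _ _ => rfl) fun t _ => by
      rw [Matrix.mulVec_add, Matrix.mulVec_mulVec, hVA, Matrix.add_mulVec]
      simp only [Matrix.mulVec_mulVec, add_assoc]
  have hlim := IsVecPrimitive.diagonal_tendsto_zero
    (fun i => by have : (0 : ℝ) ≤ ((i : ℕ) : ℝ) := Nat.cast_nonneg _
                 linarith) hw
    ((hy.mulVec L).add (hv.mulVec V))
  have hc : Continuous fun w : Fin n → ℝ => V⁻¹ *ᵥ w :=
    continuous_const.matrix_mulVec continuous_id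
  have := (hc.tendsto 0).comp hlim
  rw [Matrix.mulVec_zero] at this
  refine this.congr fun t => ?_
  simp [Matrix.mulVec_mulVec, Matrix.nonsing_inv_mul V hV]

end Decay

section Sylvester

variable {ι κ : Type*} [Fintype ι] [Fintype κ]

/-- All solutions of `x' = F x` tend to `0`. -/
def IsStable (F : Matrix ι ι ℝ) : Prop :=
  ∀ x₀ : ι → ℝ, ∃ x : ℝ → ι → ℝ, x 0 = x₀ ∧ IsVecPrimitive x (fun t => F *ᵥ x t) ∧
    Tendsto x atTop (𝓝 0)

theorem tendsto_dotProduct_mulVec {x : ℝ → ι → ℝ} {y : ℝ → κ → ℝ} (X : Matrix ι κ ℝ)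
    (hx : Tendsto x atTop (𝓝 0)) (hy : Tendsto y atTop (𝓝 0)) :
    Tendsto (fun t => x t ⬝ᵥ X *ᵥ y t) atTop (𝓝 0) := by
  have hc : Continuous fun z : (ι → ℝ) × (κ → ℝ) => z.1 ⬝ᵥ X *ᵥ z.2 :=
    continuous_fst.dotProduct (continuous_const.matrix_mulVec continuous_snd)
  have := (hc.tendsto (0, 0)).comp (hx.prodMk_nhds hy)
  simpa [Function.comp_def] using this

theorem _root_.Matrix.eq_of_dotProduct_mulVec {X Y : Matrix ι κ ℝ}
    (h : ∀ x y, x ⬝ᵥ X *ᵥ y = x ⬝ᵥ Y *ᵥ y) : X = Y := by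
  classical
  ext i j
  have := h (Pi.single i 1) (Pi.single j 1)
  simpa using this

theorem IsStable.exists_sylvester {F : Matrix ι ι ℝ} {G : Matrix κ κ ℝ} (hF : IsStable F)
    (hG : IsStable G) (W : Matrix ι κ ℝ) : ∃ X : Matrix ι κ ℝ, Fᵀ * X + X * G = W := by
  let L : Matrix ι κ ℝ →ₗ[ℝ] Matrix ι κ ℝ :=
    { toFun := fun X => Fᵀ * X + X * G
      map_add' := fun X Y => by rw [Matrix.mul_add, Matrix.add_mul]; abel
      map_smul' := fun c X => by simp }
  have hinj : Function.Injective L := by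
    rw [← LinearMap.ker_eq_bot, LinearMap.ker_eq_bot']
    intro X hX
    have hX : Fᵀ * X + X * G = 0 := hX
    refine Matrix.eq_of_dotProduct_mulVec fun x₀ y₀ => ?_
    obtain ⟨x, rfl, hx, hx0⟩ := hF x₀
    obtain ⟨y, rfl, hy, hy0⟩ := hG y₀
    have hp := hx.dotProduct (hy.mulVec X)
    have hconst : ∀ t, 0 ≤ t → x t ⬝ᵥ X *ᵥ y t = x 0 ⬝ᵥ X *ᵥ y 0 := fun t ht =>
      hp.eq_of_zero (fun s _ => by
        have : (F *ᵥ x s) ⬝ᵥ X *ᵥ y s + x s ⬝ᵥ X *ᵥ (G *ᵥ y s) =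
            x s ⬝ᵥ (Fᵀ * X + X * G) *ᵥ y s := by
          rw [Matrix.add_mulVec, dotProduct_add, ← Matrix.mulVec_mulVec, ← Matrix.mulVec_mulVec,
            Matrix.dotProduct_mulVec (x s) Fᵀ, Matrix.vecMul_transpose]
        rw [this, hX]
        simp) ht
    have h1 := tendsto_dotProduct_mulVec X hx0 hy0
    have h2 := h1.congr' ((eventually_ge_atTop 0).mono fun t ht => hconst t ht)
    rw [tendsto_nhds_unique tendsto_const_nhds h2]
    simp
  exact LinearMap.injective_iff_surjective.1 hinj W

theorem isStable_diagonal {n : ℕ} {lam : Fin n → ℝ} (hlam : ∀ i, lam i < 0) :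
    IsStable (Matrix.diagonal lam) := by
  intro x₀
  obtain ⟨x, h0, hx⟩ := exists_isVecPrimitive_linear (Matrix.diagonal lam) x₀
  refine ⟨x, h0, hx, IsVecPrimitive.diagonal_tendsto_zero (g := fun _ => 0) hlam
    (hx.congr (fun _ _ => rfl) fun t _ => by simp) fun i => by simp⟩

end Sylvester

section Quadratic

variable {ι : Type*} [Fintype ι] [DecidableEq ι]

theorem _root_.Matrix.PosDef.exists_coercive {R : Matrix ι ι ℝ} (hR : R.PosDef) :
    ∃ c, 0 < c ∧ ∀ v, c * (v ⬝ᵥ v) ≤ v ⬝ᵥ R *ᵥ v := by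
  set S := CFC.sqrt R with hS
  have hSS : S * S = R := CFC.sqrt_mul_sqrt_self R hR.posSemidef.nonneg
  have hSh : Sᵀ = S := by
    have := (Matrix.nonneg_iff_posSemidef.1 (CFC.sqrt_nonneg R)).1
    rwa [Matrix.IsHermitian, Matrix.conjTranspose_eq_transpose_of_trivial] at this
  have hSu : IsUnit S.det := by
    have := (Matrix.isUnit_iff_isUnit_det R).1 hR.isUnit
    rw [← hSS, Matrix.det_mul] at this
    exact isUnit_of_mul_isUnit_left this
  obtain ⟨c, hc, hb⟩ := (S⁻¹ᵀ * S⁻¹).exists_dotProduct_mulVec_le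
  refine ⟨1 / (2 * c + 1), by positivity, fun v => ?_⟩
  have h1 := (abs_le.1 (hb (S *ᵥ v) (S *ᵥ v))).2
  have h2 : (S *ᵥ v) ⬝ᵥ (S⁻¹ᵀ * S⁻¹) *ᵥ (S *ᵥ v) = v ⬝ᵥ v := by
    rw [← Matrix.mulVec_mulVec, Matrix.dotProduct_mulVec, Matrix.vecMul_transpose,
      Matrix.mulVec_mulVec, Matrix.nonsing_inv_mul S hSu, Matrix.one_mulVec]
  have h3 : (S *ᵥ v) ⬝ᵥ (S *ᵥ v) = v ⬝ᵥ R *ᵥ v := by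
    rw [← hSS, ← Matrix.mulVec_mulVec, Matrix.dotProduct_mulVec v S, ← Matrix.mulVec_transpose, hSh]
  rw [h2, h3] at h1
  have h4 : 0 ≤ v ⬝ᵥ R *ᵥ v := by
    simpa using hR.posSemidef.dotProduct_mulVec_nonneg v
  rw [div_mul_eq_mul_div, one_mul, div_le_iff₀ (by positivity)]
  linarith

theorem dotProduct_mulVec_eq_sqrt {Q : Matrix ι ι ℝ} (hQ : Q.PosSemidef) (v : ι → ℝ) :
    v ⬝ᵥ Q *ᵥ v = (CFC.sqrt Q *ᵥ v) ⬝ᵥ (CFC.sqrt Q *ᵥ v) := by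
  set S := CFC.sqrt Q with hS
  have hSS : S * S = Q := CFC.sqrt_mul_sqrt_self Q hQ.nonneg
  have hSh : Sᵀ = S := by
    have := (Matrix.nonneg_iff_posSemidef.1 (CFC.sqrt_nonneg Q)).1
    rwa [Matrix.IsHermitian, Matrix.conjTranspose_eq_transpose_of_trivial] at this
  rw [← hSS, ← Matrix.mulVec_mulVec, Matrix.dotProduct_mulVec v S, ← Matrix.mulVec_transpose, hSh]

end Quadratic

section Cost

variable {ι κ π : Type*} [Fintype ι] [DecidableEq ι] [Fintype κ] [Fintype π]

/-- The integrand of the cost. -/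
def costRate (C : Matrix π ι ℝ) (Q : Matrix π π ℝ) (R : Matrix κ κ ℝ)
    (u : ℝ → κ → ℝ) (x : ℝ → ι → ℝ) (t : ℝ) : ℝ :=
  (C *ᵥ x t) ⬝ᵥ (Q *ᵥ (C *ᵥ x t)) + u t ⬝ᵥ (R *ᵥ u t)

variable {A : Matrix ι ι ℝ} {B : Matrix ι κ ℝ} {C : Matrix π ι ℝ} {Q : Matrix π π ℝ}
  {R : Matrix κ κ ℝ} {u : ℝ → κ → ℝ} {x : ℝ → ι → ℝ} {x₀ : ι → ℝ}

theorem _root_.Matrix.PosSemidef.real_nonneg {P : Matrix ι ι ℝ} (hP : P.PosSemidef) (v : ι → ℝ) :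
    0 ≤ v ⬝ᵥ P *ᵥ v := by
  simpa using hP.dotProduct_mulVec_nonneg v

theorem costRate_nonneg (hQ : Q.PosSemidef) (hR : R.PosSemidef) (t : ℝ) :
    0 ≤ costRate C Q R u x t := by
  classical
  exact add_nonneg (hQ.real_nonneg _) (hR.real_nonneg _)

theorem cost_eq_ofReal (hQ : Q.PosSemidef) (hR : R.PosSemidef)
    (h : IntegrableOn (costRate C Q R u x) (Ioi 0)) :
    cost C Q R u x = ENNReal.ofReal (∫ t in Ioi (0 : ℝ), costRate C Q R u x t) := by
  rw [ofReal_integral_eq_lintegral_ofReal h (Eventually.of_forall fun t => costRate_nonneg hQ hR t)]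
  exact setLIntegral_congr Ioi_ae_eq_Ici.symm

theorem IsTrajectory.aestronglyMeasurable_input (h : IsTrajectory A B x₀ u x) :
    AEStronglyMeasurable u (volume.restrict (Ioi 0)) := by
  have hU : Ioi (0 : ℝ) ⊆ ⋃ n : ℕ, Ioc 0 (n : ℝ) := fun t ht => by
    obtain ⟨n, hn⟩ := exists_nat_ge t
    exact mem_iUnion.2 ⟨n, ht, hn⟩
  refine AEStronglyMeasurable.mono_set hU (aestronglyMeasurable_iUnion_iff.2 fun n => ?_)
  exact (h.input n n.cast_nonneg).1.aestronglyMeasurable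

theorem continuous_costRate (C : Matrix π ι ℝ) (Q : Matrix π π ℝ) (R : Matrix κ κ ℝ) :
    Continuous fun z : (ι → ℝ) × (κ → ℝ) =>
      (C *ᵥ z.1) ⬝ᵥ (Q *ᵥ (C *ᵥ z.1)) + z.2 ⬝ᵥ (R *ᵥ z.2) := by
  have h1 : Continuous fun z : (ι → ℝ) × (κ → ℝ) => C *ᵥ z.1 :=
    continuous_const.matrix_mulVec continuous_fst
  have h2 : Continuous fun z : (ι → ℝ) × (κ → ℝ) => Q *ᵥ (C *ᵥ z.1) :=
    continuous_const.matrix_mulVec h1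
  have h3 : Continuous fun z : (ι → ℝ) × (κ → ℝ) => R *ᵥ z.2 :=
    continuous_const.matrix_mulVec continuous_snd
  exact (h1.dotProduct h2).add (continuous_snd.dotProduct h3)

theorem IsTrajectory.aestronglyMeasurable_costRate (h : IsTrajectory A B x₀ u x) :
    AEStronglyMeasurable (costRate C Q R u x) (volume.restrict (Ioi 0)) := by
  have hxm : AEStronglyMeasurable x (volume.restrict (Ioi 0)) :=
    (h.state.mono Ioi_subset_Ici_self).aestronglyMeasurable measurableSet_Ioi
  have := (continuous_costRate C Q R).comp_aestronglyMeasurable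
    (hxm.prodMk h.aestronglyMeasurable_input)
  exact this

theorem IsTrajectory.integrableOn_costRate (hQ : Q.PosSemidef) (hR : R.PosSemidef)
    (h : IsTrajectory A B x₀ u x) (hfin : cost C Q R u x < ∞) :
    IntegrableOn (costRate C Q R u x) (Ioi 0) := by
  refine ⟨h.aestronglyMeasurable_costRate, (hasFiniteIntegral_iff_ofReal
    (Eventually.of_forall fun t => costRate_nonneg hQ hR t)).2 ?_⟩
  have e : cost C Q R u x = ∫⁻ t in Ioi (0 : ℝ), ENNReal.ofReal (costRate C Q R u x t) :=
    setLIntegral_congr Ioi_ae_eq_Ici.symm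
  rwa [← e]

theorem IsTrajectory.isSquareIntegrable_input [DecidableEq κ] (hQ : Q.PosSemidef) (hR : R.PosDef)
    (h : IsTrajectory A B x₀ u x) (hfin : cost C Q R u x < ∞) : IsSquareIntegrable u := by
  classical
  intro j
  have hm : AEStronglyMeasurable (fun t => u t j) (volume.restrict (Ioi 0)) :=
    (continuous_apply j).comp_aestronglyMeasurable h.aestronglyMeasurable_input
  rw [memLp_two_iff_integrable_sq hm]
  obtain ⟨c, hc, hRc⟩ := hR.exists_coercive
  refine ((h.integrableOn_costRate hQ hR.posSemidef hfin).const_mul (1 / c)).mono'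
    (hm.pow 2) (Eventually.of_forall fun t => ?_)
  rw [Real.norm_of_nonneg (sq_nonneg _), one_div, inv_mul_eq_div, le_div_iff₀ hc]
  have h1 := hRc (u t)
  have h2 : u t j * u t j ≤ u t ⬝ᵥ u t :=
    Finset.single_le_sum (f := fun i => u t i * u t i) (fun i _ => mul_self_nonneg _)
      (Finset.mem_univ j)
  have h3 := hQ.real_nonneg (C *ᵥ x t)
  have h4 := mul_le_mul_of_nonneg_left h2 hc.le
  unfold costRate
  nlinarith

theorem IsTrajectory.isSquareIntegrable_output [DecidableEq π] (hQ : Q.PosSemidef)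
    (hR : R.PosSemidef) (h : IsTrajectory A B x₀ u x) (hfin : cost C Q R u x < ∞) :
    IsSquareIntegrable (fun t => CFC.sqrt Q *ᵥ (C *ᵥ x t)) := by
  classical
  intro j
  have hc : Continuous fun v : ι → ℝ => (CFC.sqrt Q *ᵥ (C *ᵥ v)) j :=
    (continuous_apply j).comp (continuous_const.matrix_mulVec
      (continuous_const.matrix_mulVec continuous_id))
  have hm : AEStronglyMeasurable (fun t => (CFC.sqrt Q *ᵥ (C *ᵥ x t)) j)
      (volume.restrict (Ioi 0)) :=
    (hc.comp_continuousOn (h.state.mono Ioi_subset_Ici_self)).aestronglyMeasurable measurableSet_Ioi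
  rw [memLp_two_iff_integrable_sq hm]
  refine (h.integrableOn_costRate hQ hR hfin).mono' (hm.pow 2) (Eventually.of_forall fun t => ?_)
  rw [Real.norm_of_nonneg (sq_nonneg _)]
  have h2 : (CFC.sqrt Q *ᵥ (C *ᵥ x t)) j * (CFC.sqrt Q *ᵥ (C *ᵥ x t)) j ≤
      (CFC.sqrt Q *ᵥ (C *ᵥ x t)) ⬝ᵥ (CFC.sqrt Q *ᵥ (C *ᵥ x t)) :=
    Finset.single_le_sum (f := fun i => (CFC.sqrt Q *ᵥ (C *ᵥ x t)) i * (CFC.sqrt Q *ᵥ (C *ᵥ x t)) i)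
      (fun i _ => mul_self_nonneg _) (Finset.mem_univ j)
  have h3 := hR.real_nonneg (u t)
  rw [← dotProduct_mulVec_eq_sqrt hQ] at h2
  unfold costRate
  nlinarith

theorem IsVecPrimitive.isTrajectory_feedback {F : Matrix ι ι ℝ} {K : Matrix κ ι ℝ}
    (h : IsVecPrimitive x (fun t => F *ᵥ x t)) (hF : F = A - B * K) :
    IsTrajectory A B (x 0) (fun t => -(K *ᵥ x t)) x := by
  have hc : Continuous fun v : ι → ℝ => -(K *ᵥ v) :=
    (continuous_const.matrix_mulVec continuous_id).neg
  refine IsVecPrimitive.isTrajectory (h.congr (fun _ _ => rfl) fun t _ => ?_) fun t ht =>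
    ((hc.comp_continuousOn h.continuousOn_Ici).mono (uIcc_zero_subset ht)).intervalIntegrable
  rw [hF, Matrix.sub_mulVec, Matrix.mulVec_neg, Matrix.mulVec_mulVec, sub_eq_add_neg]

theorem IsTrajectory.isVecPrimitive_feedback {K : Matrix κ ι ℝ}
    (h : IsTrajectory A B x₀ (fun t => -(K *ᵥ x t)) x) :
    IsVecPrimitive x (fun t => (A - B * K) *ᵥ x t) :=
  h.isVecPrimitive.congr (fun _ _ => rfl) fun t _ => by
    rw [Matrix.sub_mulVec, Matrix.mulVec_neg, Matrix.mulVec_mulVec, sub_eq_add_neg]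

theorem exists_isTrajectory_feedback (A : Matrix ι ι ℝ) (B : Matrix ι κ ℝ) (K : Matrix κ ι ℝ)
    (x₀ : ι → ℝ) : ∃ x, IsTrajectory A B x₀ (fun t => -(K *ᵥ x t)) x := by
  obtain ⟨x, rfl, hx⟩ := exists_isVecPrimitive_linear (A - B * K) x₀
  exact ⟨x, hx.isTrajectory_feedback rfl⟩

theorem IsPrimitive.eq_zero_of_le {y f : ℝ → ℝ} (h : IsPrimitive y f) (hc : ContinuousOn f (Ici 0))
    (hf : ∀ t, 0 ≤ t → 0 ≤ f t) (h1 : y 1 ≤ y 0) : f 0 = 0 := by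
  by_contra hne
  have hpos : 0 < f 0 := lt_of_le_of_ne (hf 0 le_rfl) (Ne.symm hne)
  have := intervalIntegral.integral_pos one_pos (hc.mono Icc_subset_Ici_self)
    (fun t ht => hf t ht.1.le) ⟨0, by simp, hpos⟩
  have h2 := (h 1 zero_le_one).2
  linarith

/-- Verification theorem: a value function whose derivative along trajectories completes the
square of the cost determines the optimal gain. -/
theorem isOptimalGain_of_value (hQ : Q.PosSemidef) (hR : R.PosDef) (K : Matrix κ ι ℝ)
    (V : (ι → ℝ) → ℝ)
    (hV : ∀ x₀ u x, IsTrajectory A B x₀ u x → IsPrimitive (fun t => V (x t))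
      (fun t => (u t + K *ᵥ x t) ⬝ᵥ R *ᵥ (u t + K *ᵥ x t) - costRate C Q R u x t))
    (hlim : ∀ x₀ u x, IsTrajectory A B x₀ u x → cost C Q R u x < ∞ →
      Tendsto (fun t => V (x t)) atTop (𝓝 0))
    (hbdd : ∀ x₀ x, IsTrajectory A B x₀ (fun t => -(K *ᵥ x t)) x →
      ∃ c, ∀ t, 0 ≤ t → c ≤ V (x t)) :
    IsOptimalGain A B C Q R K ∧ ∀ K', IsOptimalGain A B C Q R K' → K' = K := by
  classical
  have hR' := hR.posSemidef
  have hlb : ∀ x₀ u x, IsTrajectory A B x₀ u x → cost C Q R u x < ∞ → ∀ s, 0 ≤ s →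
      V x₀ + (∫ t in (0 : ℝ)..s, (u t + K *ᵥ x t) ⬝ᵥ R *ᵥ (u t + K *ᵥ x t)) ≤
        ∫ t in Ioi (0 : ℝ), costRate C Q R u x t := by
    intro x₀ u x hx hfin s hs
    have hint := hx.integrableOn_costRate hQ hR' hfin
    have hl1 := intervalIntegral_tendsto_integral_Ioi 0 hint tendsto_id
    have hl2 := hl1.add (hlim x₀ u x hx hfin)
    rw [add_zero] at hl2
    refine ge_of_tendsto hl2 ((eventually_ge_atTop s).mono fun t hst => ?_)
    have ht := hs.trans hst
    have hii : ∀ r, 0 ≤ r → IntervalIntegrable (costRate C Q R u x) volume 0 r := fun r hr =>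
      (intervalIntegrable_iff_integrableOn_Ioc_of_le hr).2 (hint.mono_set Ioc_subset_Ioi_self)
    have hq : ∀ r, 0 ≤ r → IntervalIntegrable
        (fun t => (u t + K *ᵥ x t) ⬝ᵥ R *ᵥ (u t + K *ᵥ x t)) volume 0 r := fun r hr => by
      have := (hV x₀ u x hx r hr).1.add (hii r hr)
      exact this.congr fun t _ => by simp
    have e1 := (hV x₀ u x hx t ht).2
    rw [intervalIntegral.integral_sub (hq t ht) (hii t ht)] at e1
    have e2 := intervalIntegral.integral_add_adjacent_intervals (hq s hs)
      ((hq s hs).symm.trans (hq t ht))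
    have e3 : 0 ≤ ∫ r in s..t, (u r + K *ᵥ x r) ⬝ᵥ R *ᵥ (u r + K *ᵥ x r) :=
      intervalIntegral.integral_nonneg hst fun r _ => hR'.real_nonneg _
    simp only [hx.initial, id] at e1 ⊢
    linarith
  have hcl : ∀ x₀ x, IsTrajectory A B x₀ (fun t => -(K *ᵥ x t)) x →
      cost C Q R (fun t => -(K *ᵥ x t)) x = ENNReal.ofReal (V x₀) := by
    intro x₀ x hx
    have hp := (hV _ _ _ hx).const_mul (-1)
    have hp' : IsPrimitive (fun t => -1 * V (x t))
        (costRate C Q R (fun t => -(K *ᵥ x t)) x) :=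
      hp.congr (fun _ _ => rfl) fun t _ => by simp
    obtain ⟨c, hc⟩ := hbdd x₀ x hx
    have hint := hp'.integrableOn_of_bounded (fun t _ => costRate_nonneg hQ hR' t) (c := -c)
      fun t ht => by linarith [hc t ht]
    have hcost := cost_eq_ofReal hQ hR' hint
    rw [hcost]
    congr 1
    have hl1 := intervalIntegral_tendsto_integral_Ioi 0 hint tendsto_id
    have hl2 := hlim _ _ _ hx (by rw [hcost]; exact ENNReal.ofReal_lt_top)
    have hl3 := hl1.add hl2
    rw [add_zero] at hl3
    refine tendsto_nhds_unique hl3 (tendsto_const_nhds.congr' ?_)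
    filter_upwards [eventually_ge_atTop 0] with t ht
    have := (hp' t ht).2
    simp only [hx.initial] at this
    simp only [id]
    linarith
  refine ⟨fun x₀ => ?_, fun K' hK' => ?_⟩
  · obtain ⟨x, hx⟩ := exists_isTrajectory_feedback A B K x₀
    refine ⟨x, hx, by rw [hcl x₀ x hx]; exact ENNReal.ofReal_lt_top, fun u' x' hx' => ?_⟩
    rcases eq_or_ne (cost C Q R u' x') ∞ with htop | hne
    · rw [htop]
      exact le_top
    · have hfin := hne.lt_top
      rw [hcl x₀ x hx, cost_eq_ofReal hQ hR' (hx'.integrableOn_costRate hQ hR' hfin)]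
      refine ENNReal.ofReal_le_ofReal ?_
      simpa using hlb x₀ u' x' hx' hfin 0 le_rfl
  · have key : ∀ x₀, K' *ᵥ x₀ = K *ᵥ x₀ := by
      intro x₀
      obtain ⟨x', hx', hfin, hopt⟩ := hK' x₀
      obtain ⟨x, hx⟩ := exists_isTrajectory_feedback A B K x₀
      have hle := hopt _ x hx
      rw [hcl x₀ x hx, cost_eq_ofReal hQ hR' (hx'.integrableOn_costRate hQ hR' hfin)] at hle
      have hnn : 0 ≤ V x₀ := by
        have hfx : cost C Q R (fun t => -(K *ᵥ x t)) x < ∞ := by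
          rw [hcl x₀ x hx]; exact ENNReal.ofReal_lt_top
        have hp := (hV _ _ _ hx).const_mul (-1)
        have hdec : ∀ s, 0 ≤ s → V (x s) ≤ V x₀ := fun s hs => by
          have := hp.le_of_nonneg le_rfl hs fun r _ => by
            have := costRate_nonneg (C := C) (u := fun t => -(K *ᵥ x t)) (x := x) hQ hR' r
            simpa using this
          rw [hx.initial] at this
          linarith
        exact le_of_tendsto (hlim _ _ _ hx hfx) ((eventually_ge_atTop 0).mono hdec)
      have hle' := (ENNReal.ofReal_le_ofReal_iff hnn).1 hle
      have hb := hlb x₀ _ x' hx' hfin 1 zero_le_one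
      have hcont : ContinuousOn (fun t => (-(K' *ᵥ x' t) + K *ᵥ x' t) ⬝ᵥ
          R *ᵥ (-(K' *ᵥ x' t) + K *ᵥ x' t)) (Ici 0) := by
        have h1 : Continuous fun v : ι → ℝ => -(K' *ᵥ v) + K *ᵥ v :=
          (continuous_const.matrix_mulVec continuous_id).neg.add
            (continuous_const.matrix_mulVec continuous_id)
        have h2 : Continuous fun v : ι → ℝ => (-(K' *ᵥ v) + K *ᵥ v) ⬝ᵥ
          R *ᵥ (-(K' *ᵥ v) + K *ᵥ v) := h1.dotProduct (continuous_const.matrix_mulVec h1)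
        exact h2.comp_continuousOn hx'.state
      have hprim : IsPrimitive (fun s => ∫ t in (0 : ℝ)..s, (-(K' *ᵥ x' t) + K *ᵥ x' t) ⬝ᵥ
          R *ᵥ (-(K' *ᵥ x' t) + K *ᵥ x' t)) (fun t => (-(K' *ᵥ x' t) + K *ᵥ x' t) ⬝ᵥ
          R *ᵥ (-(K' *ᵥ x' t) + K *ᵥ x' t)) := fun t ht =>
        ⟨(hcont.mono (uIcc_zero_subset ht)).intervalIntegrable, by simp⟩
      have hz := hprim.eq_zero_of_le hcont (fun t _ => hR'.real_nonneg _) (by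
        simp only [intervalIntegral.integral_same]
        linarith)
      simp only [hx'.initial] at hz
      obtain ⟨c, hc, hRc⟩ := hR.exists_coercive
      have h3 := hRc (-(K' *ᵥ x₀) + K *ᵥ x₀)
      rw [hz] at h3
      have h4 := dotProduct_self_star_nonneg (-(K' *ᵥ x₀) + K *ᵥ x₀)
      simp only [star_trivial] at h4
      have h5 : (-(K' *ᵥ x₀) + K *ᵥ x₀) ⬝ᵥ (-(K' *ᵥ x₀) + K *ᵥ x₀) = 0 := by nlinarith
      have h6 := dotProduct_self_eq_zero.1 h5
      rw [neg_add_eq_sub, sub_eq_zero] at h6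
      exact h6.symm
    refine Matrix.ext_of_mulVec_single fun i => key _

end Cost

section Riccati

theorem _root_.Matrix.dotProduct_transpose_mul_mulVec {ι κ π : Type*} [Fintype ι] [Fintype κ]
    [Fintype π] (C : Matrix π ι ℝ) (X : Matrix π κ ℝ) (x : ι → ℝ) (y : κ → ℝ) :
    x ⬝ᵥ (Cᵀ * X) *ᵥ y = (C *ᵥ x) ⬝ᵥ X *ᵥ y := by
  rw [← Matrix.mulVec_mulVec, Matrix.dotProduct_mulVec x, Matrix.vecMul_transpose]

theorem _root_.Matrix.dotProduct_mulVec_transpose {ι κ : Type*} [Fintype ι] [Fintype κ]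
    (X : Matrix ι κ ℝ) (x : ι → ℝ) (y : κ → ℝ) : y ⬝ᵥ Xᵀ *ᵥ x = x ⬝ᵥ X *ᵥ y := by
  rw [Matrix.dotProduct_mulVec, Matrix.vecMul_transpose, dotProduct_comm]

variable {n : ℕ} {κ π : Type*} [Fintype κ] [Fintype π] [DecidableEq κ] [DecidableEq π]
  {A : Matrix (Fin n) (Fin n) ℝ} {B : Matrix (Fin n) κ ℝ} {C : Matrix π (Fin n) ℝ}
  {Q : Matrix π π ℝ} {R : Matrix κ κ ℝ} {K : Matrix κ (Fin n) ℝ}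

theorem IsOptimalGain.isStable (hQ : Q.PosSemidef) (hR : R.PosDef)
    (hobs : IsObservable (CFC.sqrt Q * C) A) (hK : IsOptimalGain A B C Q R K) :
    IsStable (A - B * K) := by
  intro x₀
  obtain ⟨x, hx, hfin, -⟩ := hK x₀
  refine ⟨x, hx.initial, hx.isVecPrimitive_feedback, hobs.tendsto_zero hx.isVecPrimitive
    ((hx.isSquareIntegrable_input hQ hR hfin).mulVec B) ?_⟩
  simpa only [Matrix.mulVec_mulVec] using hx.isSquareIntegrable_output hQ hR.posSemidef hfin

/-- The cost matrix of an optimal gain: it solves the Lyapunov equation of the closed loop, and is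
the stabilizing solution of the Riccati equation. -/
theorem IsOptimalGain.exists_riccati (hQ : Q.PosSemidef) (hR : R.PosDef)
    (hobs : IsObservable (CFC.sqrt Q * C) A) (hK : IsOptimalGain A B C Q R K) :
    ∃ P : Matrix (Fin n) (Fin n) ℝ, P.PosDef ∧
      (A - B * K)ᵀ * P + P * (A - B * K) + (Cᵀ * (Q * C) + Kᵀ * (R * K)) = 0 ∧ Bᵀ * P = R * K := by
  have hstab := hK.isStable hQ hR hobs
  have hQs : Qᵀ = Q := by
    have := hQ.1
    rwa [Matrix.IsHermitian, Matrix.conjTranspose_eq_transpose_of_trivial] at this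
  have hRs : Rᵀ = R := by
    have := hR.1
    rwa [Matrix.IsHermitian, Matrix.conjTranspose_eq_transpose_of_trivial] at this
  set F := A - B * K with hF
  set W := Cᵀ * (Q * C) + Kᵀ * (R * K) with hW
  have hWs : Wᵀ = W := by
    simp [hW, Matrix.transpose_mul, hQs, hRs, Matrix.mul_assoc]
  obtain ⟨X, hX⟩ := hstab.exists_sylvester hstab (-W)
  have hXt : Fᵀ * Xᵀ + Xᵀ * F = -W := by
    have := congrArg Matrix.transpose hX
    rw [Matrix.transpose_add, Matrix.transpose_mul, Matrix.transpose_mul, Matrix.transpose_neg, hWs,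
      Matrix.transpose_transpose] at this
    rw [← this, add_comm]
  set P := (1 / 2 : ℝ) • (X + Xᵀ) with hP
  have hPs : Pᵀ = P := by
    simp [hP, add_comm]
  have hlyap : Fᵀ * P + P * F + W = 0 := by
    have : Fᵀ * P + P * F = (1 / 2 : ℝ) • ((Fᵀ * X + X * F) + (Fᵀ * Xᵀ + Xᵀ * F)) := by
      simp only [hP, Matrix.mul_smul, Matrix.smul_mul, ← smul_add, Matrix.mul_add, Matrix.add_mul]
      congr 1
      abel
    rw [this, hX, hXt, ← two_smul ℝ (-W), smul_smul]
    norm_num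
  have hsymm : ∀ x y, x ⬝ᵥ P *ᵥ y = y ⬝ᵥ P *ᵥ x := fun x y => by
    conv_rhs => rw [← hPs]
    rw [Matrix.dotProduct_mulVec_transpose]
  have hform : ∀ x, 2 * (x ⬝ᵥ P *ᵥ (F *ᵥ x)) =
      -((C *ᵥ x) ⬝ᵥ Q *ᵥ (C *ᵥ x) + (K *ᵥ x) ⬝ᵥ R *ᵥ (K *ᵥ x)) := fun x => by
    have h0 : x ⬝ᵥ (Fᵀ * P + P * F + W) *ᵥ x = 0 := by rw [hlyap]; simp
    simp only [hW, Matrix.add_mulVec, dotProduct_add, Matrix.dotProduct_transpose_mul_mulVec] at h0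
    simp only [← Matrix.mulVec_mulVec] at h0
    rw [hsymm (F *ᵥ x) x] at h0
    linarith
  have hVcl : ∀ x, IsVecPrimitive x (fun t => F *ᵥ x t) →
      IsPrimitive (fun t => -1 * (x t ⬝ᵥ P *ᵥ x t))
        (costRate C Q R (fun t => -(K *ᵥ x t)) x) := fun x hx =>
    ((hx.dotProduct (hx.mulVec P)).const_mul (-1)).congr (fun _ _ => rfl) fun t _ => by
      have := hform (x t)
      rw [hsymm (F *ᵥ x t) (x t)]
      simp only [costRate, Matrix.mulVec_neg, neg_dotProduct, dotProduct_neg, neg_neg]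
      linarith
  have hnn : ∀ x₀, 0 ≤ x₀ ⬝ᵥ P *ᵥ x₀ := fun x₀ => by
    obtain ⟨x, rfl, hx, hlim⟩ := hstab x₀
    refine le_of_tendsto (tendsto_dotProduct_mulVec P hlim hlim)
      ((eventually_ge_atTop 0).mono fun t ht => ?_)
    have := (hVcl x hx).le_of_nonneg le_rfl ht fun r _ => costRate_nonneg hQ hR.posSemidef r
    linarith
  have hpsd : P.PosSemidef := by
    refine Matrix.PosSemidef.of_dotProduct_mulVec_nonneg ?_ fun x => by simpa using hnn x
    rwa [Matrix.IsHermitian, Matrix.conjTranspose_eq_transpose_of_trivial]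
  have hgrad : Bᵀ * P = R * K := by
    set G := Bᵀ * P - R * K with hG
    obtain ⟨c, hc, hRc⟩ := R.exists_dotProduct_mulVec_le
    set δ := 1 / (2 * c + 1) with hδ
    have hδ0 : 0 < δ := by positivity
    have hδR : ∀ v, δ * (v ⬝ᵥ R *ᵥ v) ≤ v ⬝ᵥ v := fun v => by
      have h1 := (abs_le.1 (hRc v v)).2
      have h2 : 0 ≤ v ⬝ᵥ v := by simpa using dotProduct_self_star_nonneg v
      rw [hδ, div_mul_eq_mul_div, one_mul, div_le_iff₀ (by positivity)]
      linarith
    have hG0 : ∀ x₀, G *ᵥ x₀ = 0 := by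
      intro x₀
      obtain ⟨z, hz⟩ := exists_isTrajectory_feedback A B (K + δ • G) x₀
      have hzv := hz.isVecPrimitive_feedback
      have hzF : ∀ v, (A - B * (K + δ • G)) *ᵥ v = F *ᵥ v - δ • (B *ᵥ (G *ᵥ v)) := fun v => by
        simp only [hF, Matrix.mul_add, Matrix.sub_mulVec, Matrix.add_mulVec, Matrix.mul_smul,
          Matrix.smul_mulVec, Matrix.mulVec_mulVec]
        abel
      have hpt : ∀ v, costRate C Q R (fun _ : ℝ => -((K + δ • G) *ᵥ v)) (fun _ => v) 0 +
          δ * ((G *ᵥ v) ⬝ᵥ (G *ᵥ v)) ≤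
          -(2 * (v ⬝ᵥ P *ᵥ ((A - B * (K + δ • G)) *ᵥ v))) := fun v => by
        have h1 := hform v
        have h2 : v ⬝ᵥ P *ᵥ (B *ᵥ (G *ᵥ v)) = (G *ᵥ v) ⬝ᵥ (Bᵀ * P) *ᵥ v := by
          rw [hsymm, ← Matrix.dotProduct_transpose_mul_mulVec, ← Matrix.dotProduct_mulVec_transpose,
            Matrix.transpose_mul]
        have h3 : Bᵀ * P = G + R * K := by rw [hG]; abel
        rw [h3, Matrix.add_mulVec, dotProduct_add, ← Matrix.mulVec_mulVec] at h2
        have h4 := hδR (G *ᵥ v)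
        have h5 : (K *ᵥ v) ⬝ᵥ R *ᵥ (G *ᵥ v) = (G *ᵥ v) ⬝ᵥ R *ᵥ (K *ᵥ v) := by
          rw [← Matrix.dotProduct_mulVec_transpose, hRs]
        rw [hzF, Matrix.mulVec_sub, dotProduct_sub, Matrix.mulVec_smul, dotProduct_smul, h2,
          smul_eq_mul]
        simp only [costRate, Matrix.mulVec_neg, neg_dotProduct, dotProduct_neg,
          Matrix.add_mulVec, Matrix.mulVec_add, dotProduct_add, add_dotProduct, Matrix.smul_mulVec,
          Matrix.mulVec_smul, dotProduct_smul, smul_dotProduct, smul_eq_mul, h5]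
        have h6 := mul_le_mul_of_nonneg_left h4 hδ0.le
        linarith
      have hzc : ContinuousOn (fun t => δ * ((G *ᵥ z t) ⬝ᵥ (G *ᵥ z t))) (Ici 0) := by
        have h1 : Continuous fun v : Fin n → ℝ => G *ᵥ v :=
          continuous_const.matrix_mulVec continuous_id
        exact (continuous_const.mul (h1.dotProduct h1)).comp_continuousOn hz.state
      have hgp : IsPrimitive (fun s => ∫ t in (0 : ℝ)..s, δ * ((G *ᵥ z t) ⬝ᵥ (G *ᵥ z t)))
          (fun t => δ * ((G *ᵥ z t) ⬝ᵥ (G *ᵥ z t))) := fun t ht =>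
        ⟨(hzc.mono (uIcc_zero_subset ht)).intervalIntegrable, by simp⟩
      have hg0 : ∀ t : ℝ, 0 ≤ t → 0 ≤ δ * ((G *ᵥ z t) ⬝ᵥ (G *ᵥ z t)) := fun t _ =>
        mul_nonneg hδ0.le (by simpa using dotProduct_self_star_nonneg (G *ᵥ z t))
      set ℓ := costRate C Q R (fun t => -((K + δ • G) *ᵥ z t)) z with hℓ
      have hℓc : ContinuousOn ℓ (Ici 0) := by
        have h1 : Continuous fun v : Fin n → ℝ => (v, -((K + δ • G) *ᵥ v)) :=
          continuous_id.prodMk (continuous_const.matrix_mulVec continuous_id).neg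
        exact ((continuous_costRate C Q R).comp h1).comp_continuousOn hz.state
      have hℓp : IsPrimitive (fun s => ∫ t in (0 : ℝ)..s, ℓ t) ℓ := fun t ht =>
        ⟨(hℓc.mono (uIcc_zero_subset ht)).intervalIntegrable, by simp⟩
      have hVp := (hzv.dotProduct (hzv.mulVec P)).const_mul (-1)
      have hdiff := hVp.add ((hℓp.add hgp).const_mul (-1))
      have hbound : ∀ t, 0 ≤ t → (∫ s in (0 : ℝ)..t, ℓ s) +
          (∫ s in (0 : ℝ)..t, δ * ((G *ᵥ z s) ⬝ᵥ (G *ᵥ z s))) ≤ x₀ ⬝ᵥ P *ᵥ x₀ := fun t ht => by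
        have := hdiff.le_of_nonneg le_rfl ht fun r _ => by
          have h1 := hpt (z r)
          rw [hsymm ((A - B * (K + δ • G)) *ᵥ z r) (z r)]
          have h2 : ℓ r = costRate C Q R (fun _ : ℝ => -((K + δ • G) *ᵥ z r)) (fun _ => z r) 0 := rfl
          rw [← h2] at h1
          linarith
        simp only [intervalIntegral.integral_same, hz.initial] at this
        have := hnn (z t)
        linarith
      have hint := hℓp.integrableOn_of_bounded (fun t _ => costRate_nonneg hQ hR.posSemidef t)
        (c := x₀ ⬝ᵥ P *ᵥ x₀) fun t ht => by
          have h1 := hbound t ht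
          have h2 := hgp.le_of_nonneg le_rfl ht fun r hr => hg0 r hr
          simp only [intervalIntegral.integral_same] at h2
          linarith
      have hJ : (∫ t in Ioi (0 : ℝ), ℓ t) ≤ x₀ ⬝ᵥ P *ᵥ x₀ -
          ∫ s in (0 : ℝ)..1, δ * ((G *ᵥ z s) ⬝ᵥ (G *ᵥ z s)) := by
        refine le_of_tendsto (intervalIntegral_tendsto_integral_Ioi 0 hint tendsto_id)
          ((eventually_ge_atTop 1).mono fun t ht => ?_)
        have h1 := hbound t (zero_le_one.trans ht)
        have h2 := hgp.le_of_nonneg zero_le_one ht fun r hr => hg0 r (zero_le_one.trans hr)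
        simp only [id]
        linarith
      obtain ⟨x, hx, hfin, hopt⟩ := hK x₀
      have hle := hopt _ z hz
      have hxint := hx.integrableOn_costRate hQ hR.posSemidef hfin
      rw [cost_eq_ofReal hQ hR.posSemidef hxint, cost_eq_ofReal hQ hR.posSemidef hint,
        ENNReal.ofReal_le_ofReal_iff (integral_nonneg fun t => costRate_nonneg hQ hR.posSemidef t)]
        at hle
      have hxlim : Tendsto x atTop (𝓝 0) := hobs.tendsto_zero hx.isVecPrimitive
        ((hx.isSquareIntegrable_input hQ hR hfin).mulVec B) (by
          simpa only [Matrix.mulVec_mulVec] using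
            hx.isSquareIntegrable_output hQ hR.posSemidef hfin)
      have hxV : x₀ ⬝ᵥ P *ᵥ x₀ = ∫ t in Ioi (0 : ℝ), costRate C Q R (fun t => -(K *ᵥ x t)) x t := by
        have h1 := (intervalIntegral_tendsto_integral_Ioi 0 hxint tendsto_id).add
          (tendsto_dotProduct_mulVec P hxlim hxlim)
        rw [add_zero] at h1
        refine tendsto_nhds_unique (tendsto_const_nhds.congr' ?_) h1
        filter_upwards [eventually_ge_atTop 0] with t ht
        have := (hVcl x hx.isVecPrimitive_feedback t ht).2
        simp only [hx.initial] at this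
        simp only [id]
        linarith
      have hz0 := hgp.eq_zero_of_le hzc hg0 (by
        simp only [intervalIntegral.integral_same]
        linarith)
      rw [hz.initial] at hz0
      exact dotProduct_self_eq_zero.1 ((mul_eq_zero.1 hz0).resolve_left hδ0.ne')
    have : G = 0 := Matrix.ext_of_mulVec_single fun i => by rw [hG0, Matrix.zero_mulVec]
    rw [hG, sub_eq_zero] at this
    exact this
  have hRinj : ∀ v, R *ᵥ v = 0 → v = 0 := fun v hv => by
    obtain ⟨c, hc, hRc⟩ := hR.exists_coercive
    have h1 := hRc v
    rw [hv, dotProduct_zero] at h1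
    have h2 : 0 ≤ v ⬝ᵥ v := by simpa using dotProduct_self_star_nonneg v
    exact dotProduct_self_eq_zero.1 (by nlinarith)
  have hker : ∀ x, P *ᵥ x = 0 → P *ᵥ (A *ᵥ x) = 0 ∧ (CFC.sqrt Q * C) *ᵥ x = 0 := by
    intro x hx
    have hKx : K *ᵥ x = 0 := hRinj _ (by
      rw [Matrix.mulVec_mulVec, ← hgrad, ← Matrix.mulVec_mulVec, hx, Matrix.mulVec_zero])
    have hFx : F *ᵥ x = A *ᵥ x := by
      rw [hF, Matrix.sub_mulVec, ← Matrix.mulVec_mulVec, hKx, Matrix.mulVec_zero, sub_zero]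
    have h1 := hform x
    rw [hsymm, hx, hKx] at h1
    simp only [dotProduct_zero, zero_dotProduct, mul_zero, add_zero] at h1
    have h2 : CFC.sqrt Q *ᵥ (C *ᵥ x) = 0 := by
      refine dotProduct_self_eq_zero.1 ?_
      rw [← dotProduct_mulVec_eq_sqrt hQ]
      linarith
    have h3 : Q *ᵥ (C *ᵥ x) = 0 := by
      conv_lhs => rw [← CFC.sqrt_mul_sqrt_self Q hQ.nonneg]
      rw [← Matrix.mulVec_mulVec, h2, Matrix.mulVec_zero]
    refine ⟨?_, by rw [← Matrix.mulVec_mulVec, h2]⟩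
    have h4 : (Fᵀ * P + P * F + W) *ᵥ x = 0 := by rw [hlyap, Matrix.zero_mulVec]
    simp only [hW, Matrix.add_mulVec, ← Matrix.mulVec_mulVec, hx, hKx, h3, Matrix.mulVec_zero,
      zero_add, add_zero] at h4
    rwa [hFx] at h4
  have hinj : ∀ x, P *ᵥ x = 0 → x = 0 := fun x hx => hobs.eq_zero fun k => by
    have : P *ᵥ (A ^ k *ᵥ x) = 0 := by
      induction k with
      | zero => simpa using hx
      | succ k ih =>
        rw [pow_succ', ← Matrix.mulVec_mulVec]
        exact (hker _ ih).1
    exact (hker _ this).2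
  refine ⟨P, Matrix.PosDef.of_dotProduct_mulVec_pos hpsd.1 fun x hx => ?_, hlyap, hgrad⟩
  refine lt_of_le_of_ne (by simpa using hnn x) fun h0 => hx (hinj x ?_)
  exact (hpsd.dotProduct_mulVec_zero_iff x).1 h0.symm

end Riccati

section Disturbance

variable {n : ℕ} {ι κ π : Type*} [Fintype ι] [DecidableEq ι] [Fintype κ] [Fintype π]
  [DecidableEq κ] [DecidableEq π]
  {A : Matrix (Fin n) (Fin n) ℝ} {B : Matrix (Fin n) κ ℝ} {C : Matrix π (Fin n) ℝ}
  {Q : Matrix π π ℝ} {R : Matrix κ κ ℝ} {K : Matrix κ (Fin n) ℝ}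

/-- If the system `(𝒜, ℬ, 𝒞)` reduces to the plant `(A, B, C)` disturbed by an exponentially
decaying signal, its optimal gain exists, is unique, and has the optimal gain of the plant as its
part acting on the plant state. -/
theorem IsOptimalGain.exists_of_reduction (hQ : Q.PosSemidef) (hR : R.PosDef)
    (hobs : IsObservable (CFC.sqrt Q * C) A) (hK : IsOptimalGain A B C Q R K)
    {lam : Fin n → ℝ} (hlam : ∀ i, lam i < 0) {D : Matrix (Fin n) (Fin n) ℝ}
    {𝒜 : Matrix ι ι ℝ} {ℬ : Matrix ι κ ℝ} {𝒞 : Matrix π ι ℝ} {S E : Matrix (Fin n) ι ℝ}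
    (hSA : S * 𝒜 = A * S + D * E) (hEA : E * 𝒜 = Matrix.diagonal lam * E)
    (hSB : S * ℬ = B) (hEB : E * ℬ = 0) (hC : 𝒞 = C * S) :
    ∃ K₂ : Matrix κ (Fin n) ℝ, IsOptimalGain 𝒜 ℬ 𝒞 Q R (K * S + K₂ * E) ∧
      ∀ K', IsOptimalGain 𝒜 ℬ 𝒞 Q R K' → K' = K * S + K₂ * E := by
  have hstab := hK.isStable hQ hR hobs
  obtain ⟨P, hP, hlyap, hgrad⟩ := hK.exists_riccati hQ hR hobs
  have hPs : Pᵀ = P := by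
    have := hP.1
    rwa [Matrix.IsHermitian, Matrix.conjTranspose_eq_transpose_of_trivial] at this
  have hRs : Rᵀ = R := by
    have := hR.1
    rwa [Matrix.IsHermitian, Matrix.conjTranspose_eq_transpose_of_trivial] at this
  set F := A - B * K with hF
  obtain ⟨X, hX⟩ := hstab.exists_sylvester (isStable_diagonal hlam) (-(P * D))
  set K₂ := R⁻¹ * (Bᵀ * X) with hK₂
  have hRK₂ : Bᵀ * X = R * K₂ := by
    rw [hK₂, Matrix.mul_nonsing_inv_cancel_left]
    exact (Matrix.isUnit_iff_isUnit_det R).1 hR.isUnit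
  obtain ⟨Y, hY⟩ := (isStable_diagonal hlam).exists_sylvester (isStable_diagonal hlam)
    (-(Dᵀ * X + Xᵀ * D - K₂ᵀ * (R * K₂)))
  set V : (ι → ℝ) → ℝ := fun ζ => (S *ᵥ ζ) ⬝ᵥ P *ᵥ (S *ᵥ ζ) + 2 * ((S *ᵥ ζ) ⬝ᵥ X *ᵥ (E *ᵥ ζ)) +
    (E *ᵥ ζ) ⬝ᵥ Y *ᵥ (E *ᵥ ζ) with hV
  have hsymm : ∀ x y, x ⬝ᵥ P *ᵥ y = y ⬝ᵥ P *ᵥ x := fun x y => by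
    conv_rhs => rw [← hPs]
    rw [Matrix.dotProduct_mulVec_transpose]
  have hsymmR : ∀ x y, x ⬝ᵥ R *ᵥ y = y ⬝ᵥ R *ᵥ x := fun x y => by
    conv_rhs => rw [← hRs]
    rw [Matrix.dotProduct_mulVec_transpose]
  have hx : ∀ x₀ u ζ, IsTrajectory 𝒜 ℬ x₀ u ζ → IsVecPrimitive (fun t => S *ᵥ ζ t)
      (fun t => A *ᵥ (S *ᵥ ζ t) + (B *ᵥ u t + D *ᵥ (E *ᵥ ζ t))) := fun x₀ u ζ h =>
    (h.isVecPrimitive.mulVec S).congr (fun _ _ => rfl) fun t _ => by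
      rw [Matrix.mulVec_add, Matrix.mulVec_mulVec, Matrix.mulVec_mulVec, hSA, hSB, Matrix.add_mulVec,
        ← Matrix.mulVec_mulVec, ← Matrix.mulVec_mulVec]
      abel
  have hε : ∀ x₀ u ζ, IsTrajectory 𝒜 ℬ x₀ u ζ → IsVecPrimitive (fun t => E *ᵥ ζ t)
      (fun t => Matrix.diagonal lam *ᵥ (E *ᵥ ζ t)) := fun x₀ u ζ h =>
    (h.isVecPrimitive.mulVec E).congr (fun _ _ => rfl) fun t _ => by
      rw [Matrix.mulVec_add, Matrix.mulVec_mulVec, Matrix.mulVec_mulVec, hEA, hEB,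
        Matrix.zero_mulVec, add_zero, ← Matrix.mulVec_mulVec]
  have hεlim : ∀ x₀ u ζ, IsTrajectory 𝒜 ℬ x₀ u ζ → Tendsto (fun t => E *ᵥ ζ t) atTop (𝓝 0) :=
    fun x₀ u ζ h => IsVecPrimitive.diagonal_tendsto_zero (g := fun _ => 0) hlam
      ((hε x₀ u ζ h).congr (fun _ _ => rfl) fun t _ => by simp) fun i => by simp
  refine ⟨K₂, isOptimalGain_of_value hQ hR (K * S + K₂ * E) V ?_ ?_ ?_⟩
  · intro x₀ u ζ h
    have h1 := hx x₀ u ζ h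
    have h2 := hε x₀ u ζ h
    refine (((h1.dotProduct (h1.mulVec P)).add ((h1.dotProduct (h2.mulVec X)).const_mul 2)).add
      (h2.dotProduct (h2.mulVec Y))).congr (fun _ _ => rfl) fun t _ => ?_
    simp only [costRate, hC, Matrix.add_mulVec, ← Matrix.mulVec_mulVec]
    generalize S *ᵥ ζ t = x
    generalize E *ᵥ ζ t = ε
    generalize u t = v
    have eF : A *ᵥ x = F *ᵥ x + B *ᵥ (K *ᵥ x) := by
      rw [hF, Matrix.sub_mulVec, ← Matrix.mulVec_mulVec]
      abel
    have e1 : 2 * (x ⬝ᵥ P *ᵥ (F *ᵥ x)) =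
        -((C *ᵥ x) ⬝ᵥ Q *ᵥ (C *ᵥ x) + (K *ᵥ x) ⬝ᵥ R *ᵥ (K *ᵥ x)) := by
      have h0 : x ⬝ᵥ (Fᵀ * P + P * F + (Cᵀ * (Q * C) + Kᵀ * (R * K))) *ᵥ x = 0 := by
        rw [hlyap]; simp
      simp only [Matrix.add_mulVec, dotProduct_add, Matrix.dotProduct_transpose_mul_mulVec] at h0
      simp only [← Matrix.mulVec_mulVec] at h0
      rw [hsymm (F *ᵥ x) x] at h0
      linarith
    have e2 : ∀ w, (B *ᵥ w) ⬝ᵥ P *ᵥ x = w ⬝ᵥ R *ᵥ (K *ᵥ x) := fun w => by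
      rw [← Matrix.dotProduct_transpose_mul_mulVec, hgrad, ← Matrix.mulVec_mulVec]
    have e3 : ∀ w, (B *ᵥ w) ⬝ᵥ X *ᵥ ε = w ⬝ᵥ R *ᵥ (K₂ *ᵥ ε) := fun w => by
      rw [← Matrix.dotProduct_transpose_mul_mulVec, hRK₂, ← Matrix.mulVec_mulVec]
    have e4 : (F *ᵥ x) ⬝ᵥ X *ᵥ ε + x ⬝ᵥ X *ᵥ (Matrix.diagonal lam *ᵥ ε) =
        -(x ⬝ᵥ P *ᵥ (D *ᵥ ε)) := by
      have := congrArg (fun Z => x ⬝ᵥ Z *ᵥ ε) hX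
      simp only [Matrix.add_mulVec, dotProduct_add, Matrix.dotProduct_transpose_mul_mulVec,
        Matrix.neg_mulVec, dotProduct_neg] at this
      simpa only [← Matrix.mulVec_mulVec] using this
    have e5 : (Matrix.diagonal lam *ᵥ ε) ⬝ᵥ Y *ᵥ ε + ε ⬝ᵥ Y *ᵥ (Matrix.diagonal lam *ᵥ ε) =
        -(2 * ((D *ᵥ ε) ⬝ᵥ X *ᵥ ε) - (K₂ *ᵥ ε) ⬝ᵥ R *ᵥ (K₂ *ᵥ ε)) := by
      have := congrArg (fun Z => ε ⬝ᵥ Z *ᵥ ε) hY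
      simp only [Matrix.add_mulVec, Matrix.sub_mulVec, dotProduct_add, dotProduct_sub,
        Matrix.dotProduct_transpose_mul_mulVec, Matrix.neg_mulVec, dotProduct_neg] at this
      simp only [← Matrix.mulVec_mulVec] at this
      rw [this, dotProduct_comm (X *ᵥ ε)]
      ring
    have e6 : (D *ᵥ ε) ⬝ᵥ P *ᵥ x = x ⬝ᵥ P *ᵥ (D *ᵥ ε) := hsymm _ _
    have e7 : ∀ w, x ⬝ᵥ P *ᵥ (B *ᵥ w) = w ⬝ᵥ R *ᵥ (K *ᵥ x) := fun w => by rw [hsymm, e2]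
    rw [eF]
    simp only [Matrix.mulVec_add, dotProduct_add, add_dotProduct, e2, e3, e6, e7]
    rw [hsymm (F *ᵥ x) x, hsymmR (K *ᵥ x) v, hsymmR (K₂ *ᵥ ε) v, hsymmR (K₂ *ᵥ ε) (K *ᵥ x)]
    linarith
  · intro x₀ u ζ h hfin
    have hε2 : IsSquareIntegrable (fun t => E *ᵥ ζ t) :=
      isSquareIntegrable_of_diagonal hlam (hε x₀ u ζ h)
    have hxlim : Tendsto (fun t => S *ᵥ ζ t) atTop (𝓝 0) := by
      refine hobs.tendsto_zero (hx x₀ u ζ h)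
        (((h.isSquareIntegrable_input hQ hR hfin).mulVec B).add (hε2.mulVec D)) ?_
      have := h.isSquareIntegrable_output hQ hR.posSemidef hfin
      simpa only [hC, Matrix.mulVec_mulVec, Matrix.mul_assoc] using this
    have hel := hεlim x₀ u ζ h
    have := ((tendsto_dotProduct_mulVec P hxlim hxlim).add
      ((tendsto_dotProduct_mulVec X hxlim hel).const_mul 2)).add
      (tendsto_dotProduct_mulVec Y hel hel)
    simpa only [mul_zero, add_zero] using this
  · intro x₀ ζ h
    obtain ⟨c, hc, hPc⟩ := hP.exists_coercive
    obtain ⟨a, ha, hXa⟩ := (Xᵀ * X).exists_dotProduct_mulVec_le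
    obtain ⟨b, hb, hYb⟩ := Y.exists_dotProduct_mulVec_le
    have hh := hε x₀ _ ζ h
    have hdec : ∀ t, 0 ≤ t → (E *ᵥ ζ t) ⬝ᵥ (E *ᵥ ζ t) ≤ (E *ᵥ ζ 0) ⬝ᵥ (E *ᵥ ζ 0) := fun t ht => by
      have := ((hh.dotProduct hh).const_mul (-1)).le_of_nonneg le_rfl ht fun r _ => ?_
      · linarith
      · have : ∀ e : Fin n → ℝ, (Matrix.diagonal lam *ᵥ e) ⬝ᵥ e ≤ 0 := fun e =>
          Finset.sum_nonpos fun i _ => by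
            rw [Matrix.mulVec_diagonal]
            nlinarith [mul_self_nonneg (e i), hlam i]
        have := this (E *ᵥ ζ r)
        rw [dotProduct_comm (E *ᵥ ζ r)]
        linarith
    refine ⟨-((2 * a / c + 2 * b) * ((E *ᵥ ζ 0) ⬝ᵥ (E *ᵥ ζ 0))), fun t ht => ?_⟩
    have h1 := hdec t ht
    simp only [hV]
    generalize S *ᵥ ζ t = x at *
    generalize E *ᵥ ζ t = e at *
    have h2 := hPc x
    have h3 := (abs_le.1 (hXa e e)).2
    rw [Matrix.dotProduct_transpose_mul_mulVec] at h3
    have h4 := (abs_le.1 (hYb e e)).1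
    have h5 : 0 ≤ (c • x + X *ᵥ e) ⬝ᵥ (c • x + X *ᵥ e) := by
      simpa using dotProduct_self_star_nonneg (c • x + X *ᵥ e)
    simp only [dotProduct_add, add_dotProduct, smul_dotProduct, dotProduct_smul, smul_eq_mul] at h5
    rw [dotProduct_comm (X *ᵥ e) x] at h5
    have h6 : 0 ≤ c * (x ⬝ᵥ x) + 2 * (x ⬝ᵥ X *ᵥ e) + (X *ᵥ e) ⬝ᵥ (X *ᵥ e) / c := by
      have : c * (x ⬝ᵥ x) + 2 * (x ⬝ᵥ X *ᵥ e) + (X *ᵥ e) ⬝ᵥ (X *ᵥ e) / c =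
        (c * (c * (x ⬝ᵥ x)) + c * (x ⬝ᵥ X *ᵥ e) + (c * (x ⬝ᵥ X *ᵥ e) +
          (X *ᵥ e) ⬝ᵥ (X *ᵥ e))) / c := by
        field_simp
        ring
      rw [this]
      exact div_nonneg (by linarith) hc.le
    have h7 : (X *ᵥ e) ⬝ᵥ (X *ᵥ e) / c ≤ 2 * a / c * (e ⬝ᵥ e) := by
      rw [div_mul_eq_mul_div]
      exact div_le_div_of_nonneg_right (by linarith) hc.le
    have h8 : 0 ≤ 2 * a / c + 2 * b := by positivity
    have h9 := mul_le_mul_of_nonneg_left h1 h8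
    linarith

end Disturbance

section Augmented

variable {n m p : ℕ}

theorem _root_.Matrix.fromCols_add_fromCols {ι κ₁ κ₂ : Type*} (X₁ Y₁ : Matrix ι κ₁ ℝ)
    (X₂ Y₂ : Matrix ι κ₂ ℝ) : Matrix.fromCols X₁ X₂ + Matrix.fromCols Y₁ Y₂ =
      Matrix.fromCols (X₁ + Y₁) (X₂ + Y₂) := by
  ext i (j | j) <;> rfl

theorem filterProj_apply (T : Matrix (Fin n) (Fin n) ℝ) (θ : FilterCol n m p → ℝ) (i : Fin n)
    (r : FilterIdx n m p) : filterProj T θ i r = θ r.1 * T⁻¹ i r.2 := rfl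

theorem filterProj_mul_filterA {T M : Matrix (Fin n) (Fin n) ℝ} (hT : IsUnit T.det)
    (θ : FilterCol n m p → ℝ) :
    filterProj T θ * filterA m p M = T⁻¹ * M * T * filterProj T θ := by
  have h : T⁻¹ * M * T * T⁻¹ = T⁻¹ * M := Matrix.mul_nonsing_inv_cancel_right _ _ hT
  ext i ⟨c, k⟩
  have e1 : (filterProj T θ * filterA m p M) i (c, k) = θ c * (T⁻¹ * M) i k := by
    simp only [Matrix.mul_apply, filterProj_apply, filterA, Matrix.kroneckerMap_apply,
      Fintype.sum_prod_type, Matrix.one_apply, Finset.mul_sum]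
    rw [Finset.sum_eq_single c (fun c' _ hc => by simp [hc]) (by simp)]
    exact Finset.sum_congr rfl fun j _ => by simp [mul_assoc]
  have e2 : (T⁻¹ * M * T * filterProj T θ) i (c, k) = θ c * (T⁻¹ * M * T * T⁻¹) i k := by
    rw [Matrix.mul_apply, Matrix.mul_apply, Finset.mul_sum]
    exact Finset.sum_congr rfl fun j _ => by
      rw [filterProj_apply]
      ring
  rw [e1, e2, h]

theorem filterProj_mul_filterL (T : Matrix (Fin n) (Fin n) ℝ) (θ : FilterCol n m p → ℝ) :
    filterProj T θ * filterL n m p = T⁻¹ * outputCoeff θ := by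
  ext i l
  simp only [Matrix.mul_apply, filterProj_apply, filterL, outputCoeff, Matrix.of_apply,
    Fintype.sum_prod_type, Fintype.sum_sum_type, Sum.elim_inl, Sum.elim_inr, mul_zero,
    Finset.sum_const_zero, add_zero, Matrix.vec, Matrix.one_apply]
  rw [Finset.sum_eq_single l (fun c' _ hc => by simp [hc]) (by simp)]
  simp [mul_comm]

theorem filterProj_mul_filterB (T : Matrix (Fin n) (Fin n) ℝ) (θ : FilterCol n m p → ℝ) :
    filterProj T θ * filterB n m p = T⁻¹ * inputCoeff θ := by
  ext i l
  simp only [Matrix.mul_apply, filterProj_apply, filterB, inputCoeff, Matrix.of_apply,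
    Fintype.sum_prod_type, Fintype.sum_sum_type, Sum.elim_inl, Sum.elim_inr, mul_zero,
    Finset.sum_const_zero, zero_add, Matrix.vec, Matrix.one_apply]
  rw [Finset.sum_eq_single l (fun c' _ hc => by simp [hc]) (by simp)]
  simp [mul_comm]

end Augmented

end KreisselmeierLQR

open KreisselmeierLQR in
theorem proposition1 {n m p : ℕ}
    (A : Matrix (Fin n) (Fin n) ℝ) (B : Matrix (Fin n) (Fin m) ℝ) (C : Matrix (Fin p) (Fin n) ℝ)
    (Q : Matrix (Fin p) (Fin p) ℝ) (R : Matrix (Fin m) (Fin m) ℝ)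
    (hQ : Q.PosSemidef) (hR : R.PosDef)
    (hAB : IsControllable A B) (hCA : IsObservable C A)
    (hQCA : IsObservable (CFC.sqrt Q * C) A)
    (M : Matrix (Fin n) (Fin n) ℝ) (hM : IsHurwitz M)
    (lam : Fin n → ℝ) (hlam : Function.Injective lam)
    (hMlam : ∀ i, Module.End.HasEigenvalue (Matrix.toLin' M) (lam i))
    (Kstar : Matrix (Fin m) (Fin n) ℝ) (hK : IsOptimalGain A B C Q R Kstar) :
    (∃ (T : Matrix (Fin n) (Fin n) ℝ) (θ : FilterCol n m p → ℝ),
      IsFilterRepresentation A B C M T θ) ∧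
    ∀ (T : Matrix (Fin n) (Fin n) ℝ) (θ : FilterCol n m p → ℝ),
      IsFilterRepresentation A B C M T θ →
      ∀ Γ : Matrix (Fin n) (Fin n) ℝ,
        ∃ Keps : Matrix (Fin m) (Fin n) ℝ,
          IsOptimalGain (augA C M T θ Γ lam) (augB n m p) (augC C T θ Γ) Q R
            (Matrix.fromCols (Kstar * filterProj T θ) Keps) ∧
          ∀ K : Matrix (Fin m) (FilterIdx n m p ⊕ Fin n) ℝ,
            IsOptimalGain (augA C M T θ Γ lam) (augB n m p) (augC C T θ Γ) Q R K →
              K = Matrix.fromCols (Kstar * filterProj T θ) Keps := by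
  refine ⟨exists_isFilterRepresentation B hCA hlam hMlam, fun T θ hrep Γ => ?_⟩
  have hT := hrep.1
  obtain ⟨hTA, hTB⟩ := hrep.eq
  have hA : A = T⁻¹ * M * T + T⁻¹ * outputCoeff θ * C := by
    rw [← Matrix.nonsing_inv_mul_cancel_left T A hT, hTA, Matrix.mul_add]
    simp only [Matrix.mul_assoc]
  have hB : B = T⁻¹ * inputCoeff θ := by
    rw [← hTB, Matrix.nonsing_inv_mul_cancel_left T B hT]
  obtain ⟨K₂, hopt, huniq⟩ := hK.exists_of_reduction hQ hR hQCA
    (fun i => hM.eigenvalue_neg (hMlam i))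
    (D := T⁻¹ * (Γ * Matrix.diagonal lam - M * Γ))
    (𝒜 := augA C M T θ Γ lam) (ℬ := augB n m p) (𝒞 := augC C T θ Γ)
    (S := Matrix.fromCols (filterProj T θ) (T⁻¹ * Γ))
    (E := Matrix.fromCols (0 : Matrix (Fin n) (FilterIdx n m p) ℝ) (1 : Matrix (Fin n) (Fin n) ℝ))
    (by
      have e1 : filterProj T θ * realA C M T θ = A * filterProj T θ := by
        rw [realA, Matrix.mul_add, filterProj_mul_filterA hT, ← Matrix.mul_assoc,
          filterProj_mul_filterL, realC, ← Matrix.mul_assoc, ← Matrix.add_mul, ← hA]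
      have e2 : filterProj T θ * (filterL n m p * C * T⁻¹ * Γ) =
          T⁻¹ * outputCoeff θ * C * (T⁻¹ * Γ) := by
        simp only [← Matrix.mul_assoc, filterProj_mul_filterL]
      have e3 : A * (T⁻¹ * Γ) = T⁻¹ * M * Γ + T⁻¹ * outputCoeff θ * C * (T⁻¹ * Γ) := by
        conv_lhs => rw [hA]
        rw [Matrix.add_mul, Matrix.mul_assoc (T⁻¹ * M), Matrix.mul_nonsing_inv_cancel_left T Γ hT]
      rw [augA, Matrix.fromCols_mul_fromBlocks, Matrix.mul_fromCols, Matrix.mul_fromCols,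
        Matrix.fromCols_add_fromCols, e1, e2, e3]
      simp only [Matrix.mul_zero, add_zero, Matrix.mul_one, Matrix.mul_sub, Matrix.mul_assoc]
      congr 1
      abel)
    (by simp [augA, Matrix.fromCols_mul_fromBlocks, Matrix.mul_fromCols])
    (by
      rw [augB, Matrix.fromCols_mul_fromRows, filterProj_mul_filterB, Matrix.mul_zero, add_zero,
        ← hB])
    (by simp [augB, Matrix.fromCols_mul_fromRows])
    (by rw [augC, realC, Matrix.mul_fromCols, Matrix.mul_assoc])
  have hgain : Kstar * Matrix.fromCols (filterProj T θ) (T⁻¹ * Γ) +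
      K₂ * Matrix.fromCols (0 : Matrix (Fin n) (FilterIdx n m p) ℝ) (1 : Matrix (Fin n) (Fin n) ℝ) =
      Matrix.fromCols (Kstar * filterProj T θ) (Kstar * (T⁻¹ * Γ) + K₂) := by
    rw [Matrix.mul_fromCols, Matrix.mul_fromCols, Matrix.fromCols_add_fromCols, Matrix.mul_zero,
      Matrix.mul_one, add_zero]
  exact ⟨Kstar * (T⁻¹ * Γ) + K₂, hgain ▸ hopt, fun K hK' => hgain ▸ huniq K hK'⟩
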